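/- Let $n\ge 1$ and let $T^n=(S^1)^n\subset\mathbb C^n$ be the flat torus with the induced metric $g$, parametrized by $u\in\mathbb R^n/\mathbb Z^n$ via $u\mapsto(e^{2\pi i u^1},\dots,e^{2\pi i u^n})$, so that $g=(2\pi)^2\sum_j du^j\otimes du^j$. Let $(u,v)\in(\mathbb R^n/\mathbb Z^n)\times\mathbb R^n$ be the induced coordinates on $T^*T^n$, in which the point $(u,v)$ is $(e^{2\pi i u^j},\,\tfrac{-i}{2\pi}v_je^{-2\pi i u^j})_j\in\mathbb C^n\times(\mathbb C^n)^*$; let $\Theta=\sum_j v_j\,du^j$ be the Liouville form and $H_0(z)=\tfrac12|z|^2=\frac{1}{2(2\pi)^2}\sum_j v_j^2$. On the free loop space $\Lambda T^*T^n=H^1(\mathbb R/\mathbb Z,T^*T^n)$, with the topology of the $H^1$ norm inherited from $\mathbb C^n\times(\mathbb C^n)^*$, consider the symplectic action $$\mathcal A(z)=\int_{\mathbb R/\mathbb Z}z^*\Theta-\int_0^1H_0(z(t))\,dt .$$ For $a\in\mathbb R$ let $\mathrm{Crit}_a\,\mathcal A$ be the space of critical points $z$ of $\mathcal A$ with $\mathcal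 A(z)\le a$, with the subspace topology. Let the Bott-type Floer cochain complex be the singular chain complex of $\mathrm{Crit}_a\,\mathcal A$ with the negative grading: $CF^{-i}_{a,Bott}=C_i^{sing}(\mathrm{Crit}_a\,\mathcal A;\mathbb Z)$ for $i\ge 0$ and $CF^{-i}_{a,Bott}=0$ for $i<0$, with the singular boundary operator $CF^{-i}\to CF^{-i+1}$ as coboundary operator; let $HF^{-i}_{a,Bott}$, $i\in\mathbb Z$, be its cohomology. Then: 1. The critical points of $\mathcal A$ are exactly the loops $x_{u_0,l}(t)=(lt+u_0,(2\pi)^2l)$ with $l\in\mathbb Z^n$, $u_0\in\mathbb R^n/\mathbb Z^n$. The map $(l,u_0)\mapsto x_{u_0,l}$ is a homeomorphism from the disjoint union $\bigsqcup_{l\in\mathbb Z^n}T^n$ onto the set of critical points, and $\mathcal A(x_{u_0,l})=2\pi^2|l|^2$, where $|l|$ is the Euclidean norm. 2. For every $k\in\mathbb Z^n$ and $a=2\pi^2|k|^2$, $$HF^{-i}_{a,Bott}(T^*T^n,H_0,g;\mathbb Z)\cong\begin{cases}\bigoplus_{l\in\mathbb Z^n,\ |l|\le|k|}\mathbb Z^{\binom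 ni}&\text{for } -i=-n,\dots,0,\\ 0&\text{otherwise.}\end{cases}$$ -/

import Mathlib

open MeasureTheory CategoryTheory
open scoped ContDiff DirectSum

noncomputable section

namespace FloerBott

/-- The coordinate space `ℂⁿ` with its Hermitian norm. -/
abbrev Cn (n : ℕ) : Type := EuclideanSpace ℂ (Fin n)

/-- `ℂⁿ × (ℂⁿ)*` with the Euclidean product norm; a covector `η` is stored by its components
`η_j` in the dual standard basis, so that `η(ξ) = ∑ j, η_j ξ_j`. -/
abbrev Ambient (n : ℕ) : Type := WithLp 2 (Cn n × Cn n)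

/-- The torus `Tⁿ = (ℝ/ℤ)ⁿ`. -/
abbrev Torus (n : ℕ) : Type := Fin n → UnitAddCircle

/-- The natural coordinates `(u, v) ∈ (ℝ/ℤ)ⁿ × ℝⁿ` on `T*Tⁿ ⊂ ℂⁿ × (ℂⁿ)*`:
`(u, v) ↦ (e^{2πi u^j}, (-i/2π) v_j e^{-2πi u^j})_j`. The point `u` of the torus is sent to
`(e^{2πi u^j})_j ∈ (S¹)ⁿ ⊂ ℂⁿ`, and `v` stands for the covector `∑ v_j du^j` at that point. -/
def param {n : ℕ} (u : Torus n) (v : Fin n → ℝ) : Ambient n :=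
  WithLp.toLp 2
    (WithLp.toLp 2 fun j => ((u j).toCircle : ℂ),
     WithLp.toLp 2 fun j =>
      -(Complex.I / (2 * (Real.pi : ℂ))) * (v j : ℂ) * ((-(u j)).toCircle : ℂ))

/-- The cotangent bundle `T*Tⁿ` as a subset of `ℂⁿ × (ℂⁿ)*`. -/
def cotangentTorus (n : ℕ) : Set (Ambient n) :=
  {p | ∃ (u : Torus n) (v : Fin n → ℝ), param u v = p}

/-- The Liouville form: the covector `p = (x, y)` evaluated on the base component `ξ` of the
tangent vector `ζ = (ξ, η)`. It is real on `T*Tⁿ`, where it reads `∑ v_j du^j`. -/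
def liouville {n : ℕ} (p ζ : Ambient n) : ℝ := (∑ j, p.snd j * ζ.fst j).re

/-- The Hamiltonian `H₀(p) = |p|²/2`, where `|p|` is the length of the covector. -/
def hamiltonian {n : ℕ} (p : Ambient n) : ℝ := ‖p.snd‖ ^ 2 / 2

/-- `L²(ℝ/ℤ, ℂⁿ × (ℂⁿ)*)`. -/
abbrev L2 (n : ℕ) : Type := Lp (Ambient n) 2 (volume : Measure UnitAddCircle)

/-- `w` is the weak derivative of `f` on the circle `ℝ/ℤ`: `∫ φ' f = -∫ φ w` for every smooth
`φ : ℝ/ℤ → ℝ` (`ψ` being the derivative of `φ`). -/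
def IsWeakDeriv {n : ℕ} (f w : L2 n) : Prop :=
  ∀ φ ψ : UnitAddCircle → ℝ, ContDiff ℝ ∞ (fun t : ℝ => φ t) →
    (∀ t : ℝ, HasDerivAt (fun s : ℝ => φ s) (ψ t) t) →
    ∫ t, ψ t • f t = -∫ t, φ t • w t

/-- Pairs `(z, w)` of square-integrable maps, with `‖(z, w)‖² = ‖z‖² + ‖w‖²`. On the pairs with
`w` the weak derivative of `z`, which form a closed subspace, this is the `H¹` norm of `z`. -/
abbrev Pair (n : ℕ) : Type := WithLp 2 (L2 n × L2 n)

/-- The free loop space `ΛT*Tⁿ = H¹(ℝ/ℤ, T*Tⁿ)`; a loop `z` is stored together with its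
derivative as the pair `(z, ∂ₜz)`, and the distance is the one of the `H¹` norm. -/
def loopSpace (n : ℕ) : Set (Pair n) :=
  {z | IsWeakDeriv z.fst z.snd ∧ ∀ᵐ t, z.fst t ∈ cotangentTorus n}

/-- The symplectic action `∫ z*Θ - ∫ H₀(z(t)) dt`. -/
def action {n : ℕ} (z : Pair n) : ℝ :=
  (∫ t, liouville (z.fst t) (z.snd t)) - ∫ t, hamiltonian (z.fst t)

/-- The critical points of the symplectic action on `ΛT*Tⁿ`: the loops at which the action is
stationary along every differentiable curve of loops. -/
def crit (n : ℕ) : Set (Pair n) :=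
  {z | z ∈ loopSpace n ∧ ∀ c : ℝ → Pair n, (∀ s, c s ∈ loopSpace n) → c 0 = z →
    DifferentiableAt ℝ c 0 → HasDerivAt (fun s => action (c s)) 0 0}

/-- The critical points of action at most `a`. -/
def critBelow (n : ℕ) (a : ℝ) : Set (Pair n) := {z | z ∈ crit n ∧ action z ≤ a}

/-- The Euclidean norm of an integer vector. -/
def intNorm {n : ℕ} (l : Fin n → ℤ) : ℝ := Real.sqrt (∑ j, (l j : ℝ) ^ 2)

/-- The loop `x_{u₀,l}(t) = (l t + u₀, (2π)² l)` in the natural coordinates of `T*Tⁿ`. -/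
def critLoop {n : ℕ} (l : Fin n → ℤ) (u₀ : Torus n) (t : UnitAddCircle) : Ambient n :=
  param (fun j => l j • t + u₀ j) (fun j => (2 * Real.pi) ^ 2 * (l j : ℝ))

/-- The Bott-type Floer cochain complex: in degree `-i` the singular `i`-chains (with
coefficients in `ℤ`) of the space of critical points of action at most `a`, topologized as a
subspace of the loop space; zero in positive degrees; the coboundary operator is the singular
boundary operator. -/
def floerComplex (n : ℕ) (a : ℝ) : CochainComplex (ModuleCat.{0} ℤ) ℤ :=
  (((AlgebraicTopology.singularChainComplexFunctor (ModuleCat.{0} ℤ)).obj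
    (ModuleCat.of ℤ ℤ)).obj (TopCat.of (critBelow n a))).extend ComplexShape.embeddingDownNat

/-- The Bott-type Floer cohomology group in degree `m`. -/
def floerCohomology (n : ℕ) (a : ℝ) (m : ℤ) : ModuleCat.{0} ℤ := (floerComplex n a).homology m

end FloerBott

end

/-!
The two assertions concern the critical points of the action and the singular homology of the
space they form.

**Critical points.** A loop in `T*Tⁿ ⊂ ℂⁿ × (ℂⁿ)*` is a family of `n` loops `(x, y)` in
`T*S¹ ⊂ ℂ × ℂ*`, described by `|x| = 1` and `Re (x y) = 0`, and the action is the sum of the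
actions of these (`FloerBott.mem_loopSpace_iff`, `FloerBott.action_eq_sum`). Hence a loop is
critical exactly when each of its coordinates is (`FloerBott.mem_crit_iff`), and it suffices to
treat `T*S¹`. There, varying the covector gives `conj x · x' + x y = 0`
(`CircleL2.Quad.IsCrit.conj_mul_add_mul_eq_zero`), and rotating the base point by `e^{isφ}` shows
that the momentum `x y` is constant (`CircleL2.Quad.IsCrit.exists_mul_eq_const`). Therefore
`x' = λ x` for a constant `λ`; comparing Fourier coefficients, `λ = 2πil` and `x = c e^{2πilt}`
with `|c| = 1`. Conversely, near such a loop the action varies at most quadratically in the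
distance (`CircleL2.exists_abs_act_sub_le`): the linear part of the difference, transformed by
integration by parts, is a multiple of `Re ⟪x, x₁ - x⟫` for loops `x`, `x₁` on the unit sphere of
`L²`, hence itself quadratic. All of this takes place in `L²`, where weak derivatives are handled
through Fourier coefficients; no Sobolev embedding is needed. Finally `l` and `c` depend
continuously on the loop, because `c` is the only nonvanishing Fourier coefficient of `x` and `l`
its index (`CircleL2.critQuadHomeomorph`).

**Homology.** The critical points of action at most `2π²|k|²` are homeomorphic to `Tⁿ × L`, where
`L` is the discrete set of integer vectors with `|l| ≤ |k|`. For any space `X` the sequence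
`0 → S(ℝ × X) → S(ℝ × X) → S(ℝ/ℤ × X) → 0` of singular chains, the first map being the difference
of the unit translation and the identity, is exact: simplices of `ℝ/ℤ × X` lift uniquely up to
integer translation (`CircleProd.chainSeq_shortExact`). The translation is homotopic to the
identity, so the long exact sequence gives `H_{i+1}(S¹ × X) ≅ H_{i+1}(X) ⊕ H_i(X)` if `H_i(X)` is
free (`CircleProd.nonempty_H_succ_addEquiv`), and by Pascal's rule `H_i(Tⁿ × L)` is free on `L`
times a set with `n.choose i` elements (`CircleProd.nonempty_H_torus_prod`).
-/

/-! ### Singular homology of a product with the circle -/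

namespace CircleProd

open CategoryTheory Limits AlgebraicTopology Simplicial

/-- Translation of the real factor of `ℝ × X` by the integer `k`. -/
def shift (X : Type) [TopologicalSpace X] (k : ℤ) : TopCat.of (ℝ × X) ⟶ TopCat.of (ℝ × X) :=
  TopCat.ofHom ⟨fun p => (p.1 + k, p.2), by fun_prop⟩

/-- The covering `ℝ × X → ℝ/ℤ × X`. -/
def proj (X : Type) [TopologicalSpace X] : TopCat.of (ℝ × X) ⟶ TopCat.of (UnitAddCircle × X) :=
  TopCat.ofHom ⟨fun p => ((p.1 : UnitAddCircle), p.2),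
    (continuous_quotient_mk'.comp continuous_fst).prodMk continuous_snd⟩

instance (n : ℕ) : ContractibleSpace (SimplexCategory.toTop.{0}.obj ⦋n⦌) := by
  have h : ContractibleSpace (stdSimplex ℝ (Fin (n + 1))) :=
    (convex_stdSimplex ℝ _).contractibleSpace
      ⟨_, (Classical.arbitrary (stdSimplex ℝ (Fin (n + 1)))).2⟩
  exact Homeomorph.contractibleSpace (Y := stdSimplex ℝ (Fin (n + 1))) Homeomorph.ulift

instance (n : ℕ) : LocallyPathConnectedSpace (SimplexCategory.toTop.{0}.obj ⦋n⦌) := by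
  have h : LocallyPathConnectedSpace (stdSimplex ℝ (Fin (n + 1))) :=
    (convex_stdSimplex ℝ _).locallyPathConnectedSpace
  have e := Homeomorph.ulift (X := stdSimplex ℝ (Fin (n + 1)))
  exact e.isOpenEmbedding.locallyPathConnectedSpace

variable {X : Type} [TopologicalSpace X]

/-- Every singular simplex of `ℝ/ℤ × X` lifts to `ℝ × X`. -/
lemma exists_lift {D : TopCat.{0}} [ContractibleSpace D] [LocallyPathConnectedSpace D]
    (b : D ⟶ TopCat.of (UnitAddCircle × X)) : ∃ a : D ⟶ TopCat.of (ℝ × X), a ≫ proj X = b := by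
  obtain ⟨d⟩ : Nonempty D := inferInstance
  obtain ⟨r, hr⟩ := QuotientAddGroup.mk_surjective (b.hom d).1
  obtain ⟨F, ⟨-, hF⟩, -⟩ := (AddCircle.isCoveringMap_coe (1 : ℝ)).existsUnique_continuousMap_lifts
    ⟨fun x => (b.hom x).1, continuous_fst.comp b.hom.continuous⟩ d r hr
  refine ⟨TopCat.ofHom ⟨fun x => (F x, (b.hom x).2), by fun_prop⟩, ?_⟩
  exact TopCat.hom_ext (ContinuousMap.ext fun x => Prod.ext (congrFun hF x) rfl)

/-- Two lifts of a singular simplex differ by a unique integer translation. -/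
lemma existsUnique_shift {D : TopCat.{0}} [ContractibleSpace D] {a a' : D ⟶ TopCat.of (ℝ × X)}
    (h : a ≫ proj X = a' ≫ proj X) : ∃! k : ℤ, a' = a ≫ shift X k := by
  have hx (x : D) : (((a.hom x).1 : UnitAddCircle), (a.hom x).2) =
      (((a'.hom x).1 : UnitAddCircle), (a'.hom x).2) := ConcreteCategory.congr_hom h x
  have hz (x : D) : ∃ k : ℤ, (k : ℝ) = (a'.hom x).1 - (a.hom x).1 := by
    have h1 := (QuotientAddGroup.eq.1 (Prod.ext_iff.1 (hx x)).1)
    obtain ⟨k, hk⟩ := AddSubgroup.mem_zmultiples_iff.1 h1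
    exact ⟨k, by simpa [neg_add_eq_sub] using hk⟩
  choose f hf using hz
  have hfc : Continuous f := by
    rw [Int.isClosedEmbedding_coe_real.isEmbedding.continuous_iff]
    have : ((Int.cast : ℤ → ℝ) ∘ f) = fun x => (a'.hom x).1 - (a.hom x).1 := funext hf
    rw [this]
    exact (continuous_fst.comp a'.hom.continuous).sub (continuous_fst.comp a.hom.continuous)
  obtain ⟨d⟩ : Nonempty D := inferInstance
  have hconst (x : D) : f x = f d := PreconnectedSpace.constant inferInstance hfc
  refine ⟨f d, ?_, ?_⟩
  · refine TopCat.hom_ext (ContinuousMap.ext fun x => ?_)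
    refine Prod.ext ?_ (Prod.ext_iff.1 (hx x)).2.symm
    change (a'.hom x).1 = (a.hom x).1 + (f d : ℝ)
    rw [← hconst x, hf]; ring
  · intro k hk
    have : (a'.hom d).1 = (a.hom d).1 + (k : ℝ) := by rw [hk]; rfl
    have h2 := hf d
    rw [this] at h2
    exact_mod_cast (by linarith : (k : ℝ) = f d)

lemma shift_proj (k : ℤ) : shift X k ≫ proj X = proj X := by
  refine TopCat.hom_ext (ContinuousMap.ext fun x => Prod.ext ?_ rfl)
  change ((x.1 + k : ℝ) : UnitAddCircle) = (x.1 : UnitAddCircle)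
  rw [AddCircle.coe_add, (AddCircle.coe_eq_zero_iff (1 : ℝ) (x := (k : ℝ))).2 ⟨k, by simp⟩,
    add_zero]

lemma shift_zero : shift X 0 = 𝟙 _ := by
  refine TopCat.hom_ext (ContinuousMap.ext fun x => Prod.ext ?_ rfl)
  change x.1 + ((0 : ℤ) : ℝ) = x.1
  simp

lemma shift_comp (k l : ℤ) : shift X k ≫ shift X l = shift X (k + l) := by
  refine TopCat.hom_ext (ContinuousMap.ext fun x => Prod.ext ?_ rfl)
  change x.1 + (k : ℝ) + (l : ℝ) = x.1 + ((k + l : ℤ) : ℝ)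
  push_cast; ring

/-- Summation over `ℤ`: every function on the integers is the difference of another one. -/
lemma exists_sum_int {G : Type*} [AddCommGroup G] (g : ℤ → G) :
    ∃ u : ℤ → G, u 0 = 0 ∧ ∀ k, u (k + 1) - u k = g k := by
  let u : ℤ → G := Int.rec (fun n => ∑ i ∈ Finset.range n, g i)
    (fun n => -∑ i ∈ Finset.range (n + 1), g (Int.negSucc i))
  refine ⟨u, rfl, ?_⟩
  rintro (n | _ | n)
  · change ∑ i ∈ Finset.range (n + 1), g i - ∑ i ∈ Finset.range n, g i = g n
    simp [Finset.sum_range_succ]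
  · change ∑ i ∈ Finset.range 0, g i - -∑ i ∈ Finset.range 1, g (Int.negSucc i) = _
    simp
  · change -∑ i ∈ Finset.range (n + 1), g (Int.negSucc i) -
      -∑ i ∈ Finset.range (n + 2), g (Int.negSucc i) = _
    rw [Finset.sum_range_succ _ (n + 1)]
    abel

variable (X) in
/-- The sequence `0 → S(ℝ × X) → S(ℝ × X) → S(ℝ/ℤ × X) → 0` of singular chain complexes, whose
first map is the difference of the unit translation and the identity. -/
noncomputable def chainSeq (R : ModuleCat.{0} ℤ) :
    ShortComplex (ChainComplex (ModuleCat.{0} ℤ) ℕ) where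
  X₁ := ((singularChainComplexFunctor (ModuleCat.{0} ℤ)).obj R).obj (TopCat.of (ℝ × X))
  X₂ := ((singularChainComplexFunctor (ModuleCat.{0} ℤ)).obj R).obj (TopCat.of (ℝ × X))
  X₃ := ((singularChainComplexFunctor (ModuleCat.{0} ℤ)).obj R).obj
    (TopCat.of (UnitAddCircle × X))
  f := ((singularChainComplexFunctor (ModuleCat.{0} ℤ)).obj R).map (shift X 1) - 𝟙 _
  g := ((singularChainComplexFunctor (ModuleCat.{0} ℤ)).obj R).map (proj X)
  zero := by
    rw [Preadditive.sub_comp, ← Functor.map_comp, shift_proj, Category.id_comp, sub_self]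

/-- The generator of the singular chains of `Y` given by a singular simplex. -/
noncomputable abbrev gen {Y : TopCat.{0}} (R : ModuleCat.{0} ℤ) {n : ℕ}
    (a : SimplexCategory.toTop.{0}.obj ⦋n⦌ ⟶ Y) :
    R ⟶ (((singularChainComplexFunctor (ModuleCat.{0} ℤ)).obj R).obj Y).X n :=
  (TopCat.toSSet.obj Y).ιChainComplex (n := n) ⟨a⟩

lemma gen_map {Y Z : TopCat.{0}} (R : ModuleCat.{0} ℤ) {n : ℕ}
    (a : SimplexCategory.toTop.{0}.obj ⦋n⦌ ⟶ Y) (f : Y ⟶ Z) :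
    gen R a ≫ (((singularChainComplexFunctor (ModuleCat.{0} ℤ)).obj R).map f).f n =
      gen R (a ≫ f) :=
  SSet.ι_chainComplexMap_f (X := TopCat.toSSet.obj Y) (Y := TopCat.toSSet.obj Z)
    (TopCat.toSSet.map f) R ⟨a⟩

lemma gen_hom_ext {Y : TopCat.{0}} {R T : ModuleCat.{0} ℤ} {n : ℕ}
    {f g : (((singularChainComplexFunctor (ModuleCat.{0} ℤ)).obj R).obj Y).X n ⟶ T}
    (h : ∀ a : SimplexCategory.toTop.{0}.obj ⦋n⦌ ⟶ Y, gen R a ≫ f = gen R a ≫ g) : f = g :=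
  SSet.chainComplex_hom_ext (X := TopCat.toSSet.obj Y) fun x => h x.down

/-- Maps out of the singular chains are defined by their values on the generators. -/
lemma exists_desc {Y : TopCat.{0}} {R T : ModuleCat.{0} ℤ} {n : ℕ}
    (φ : (SimplexCategory.toTop.{0}.obj ⦋n⦌ ⟶ Y) → (R ⟶ T)) :
    ∃ f : (((singularChainComplexFunctor (ModuleCat.{0} ℤ)).obj R).obj Y).X n ⟶ T,
      ∀ a, gen R a ≫ f = φ a :=
  ⟨Cofan.IsColimit.desc ((TopCat.toSSet.obj Y).isColimitChainComplexXCofan R n)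
      fun x => φ x.down,
    fun a => Cofan.IsColimit.fac ((TopCat.toSSet.obj Y).isColimitChainComplexXCofan R n)
      (fun x => φ x.down) ⟨a⟩⟩

/-- A choice of lifts of the singular simplices of `ℝ/ℤ × X` identifies the singular simplices
of `ℝ × X` with pairs of an integer and a singular simplex of `ℝ/ℤ × X`; in these terms the
sequence is split in each degree by summation over `ℤ`. -/
lemma chainSeq_shortExact (R : ModuleCat.{0} ℤ) : (chainSeq X R).ShortExact := by
  refine HomologicalComplex.shortExact_of_degreewise_shortExact _ fun n => ?_
  choose s hs using fun b : SimplexCategory.toTop.{0}.obj ⦋n⦌ ⟶ TopCat.of (UnitAddCircle × X) =>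
    exists_lift b
  have hk (a : SimplexCategory.toTop.{0}.obj ⦋n⦌ ⟶ TopCat.of (ℝ × X)) :
      ∃! k : ℤ, a = s (a ≫ proj X) ≫ shift X k := existsUnique_shift (hs _)
  choose k hk hku using hk
  -- `u b` sums the translates of the lift `s b`, so that the retraction `r` inverts the difference
  -- of the translation and the identity.
  choose u hu0 hu using fun b => exists_sum_int fun i : ℤ => gen R (s b ≫ shift X i)
  obtain ⟨r, hr⟩ := exists_desc (R := R) fun a => u (a ≫ proj X) (k a)
  obtain ⟨σ, hσ⟩ := exists_desc (R := R) fun b => gen R (s b)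
  have hk1 (b) (i : ℤ) : k (s b ≫ shift X i) = i :=
    (hku _ i (by simp only [Category.assoc, shift_proj, hs])).symm
  have hD (b) (i : ℤ) : u b i ≫ ((((singularChainComplexFunctor (ModuleCat.{0} ℤ)).obj R).map
      (shift X 1)).f n - 𝟙 _) = gen R (s b ≫ shift X i) - gen R (s b) := by
    have key (i : ℤ) : (u b (i + 1) - u b i) ≫
        ((((singularChainComplexFunctor (ModuleCat.{0} ℤ)).obj R).map (shift X 1)).f n - 𝟙 _) =
        gen R (s b ≫ shift X (i + 1)) - gen R (s b ≫ shift X i) := by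
      rw [hu, Preadditive.comp_sub, gen_map, Category.assoc, shift_comp, Category.comp_id]
    induction i using Int.induction_on with
    | zero => rw [hu0, zero_comp, shift_zero, Category.comp_id, sub_self]
    | succ i ih =>
      have := key i
      rw [Preadditive.sub_comp, ih] at this
      rw [sub_eq_iff_eq_add.1 this]; abel
    | pred i ih =>
      have := key (-i - 1)
      rw [sub_add_cancel, Preadditive.sub_comp, ih] at this
      rw [← sub_eq_iff_eq_add'.2 (sub_eq_iff_eq_add.1 this)]; abel
  have hid : r ≫ ((((singularChainComplexFunctor (ModuleCat.{0} ℤ)).obj R).map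
      (shift X 1)).f n - 𝟙 _) + (((singularChainComplexFunctor (ModuleCat.{0} ℤ)).obj R).map
      (proj X)).f n ≫ σ = 𝟙 _ := by
    refine gen_hom_ext fun a => ?_
    rw [Preadditive.comp_add, ← Category.assoc, hr, ← Category.assoc, gen_map, hσ, hD, ← hk a,
      Category.comp_id, sub_add_cancel]
  have hfr : ((((singularChainComplexFunctor (ModuleCat.{0} ℤ)).obj R).map
      (shift X 1)).f n - 𝟙 _) ≫ r = 𝟙 _ := by
    refine gen_hom_ext fun a => ?_
    rw [Preadditive.sub_comp, Preadditive.comp_sub, ← Category.assoc, gen_map, Category.id_comp,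
      hr, hr, Category.assoc, shift_proj, Category.comp_id]
    have : k (a ≫ shift X 1) = k a + 1 := by
      conv_lhs => rw [hk a, Category.assoc, shift_comp, hk1]
    rw [this, hu, ← hk a]
  have hsg : σ ≫ (((singularChainComplexFunctor (ModuleCat.{0} ℤ)).obj R).map
      (proj X)).f n = 𝟙 _ := by
    refine gen_hom_ext fun b => ?_
    rw [← Category.assoc, hσ, gen_map, hs, Category.comp_id]
  exact ShortComplex.Splitting.shortExact { r := r, s := σ, f_r := hfr, s_g := hsg, id := hid }

/-- Singular homology with integral coefficients. -/
noncomputable abbrev H (i : ℕ) (Y : Type) [TopologicalSpace Y] : ModuleCat.{0} ℤ :=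
  (((singularChainComplexFunctor (ModuleCat.{0} ℤ)).obj (ModuleCat.of ℤ ℤ)).obj
    (TopCat.of Y)).homology i

/-- The map induced in homology. -/
noncomputable abbrev Hmap (i : ℕ) {Y Z : Type} [TopologicalSpace Y] [TopologicalSpace Z]
    (f : TopCat.of Y ⟶ TopCat.of Z) : H i Y ⟶ H i Z :=
  HomologicalComplex.homologyMap
    (((singularChainComplexFunctor (ModuleCat.{0} ℤ)).obj (ModuleCat.of ℤ ℤ)).map f) i

lemma Hmap_comp (i : ℕ) {Y Z W : Type} [TopologicalSpace Y] [TopologicalSpace Z]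
    [TopologicalSpace W] (f : TopCat.of Y ⟶ TopCat.of Z) (g : TopCat.of Z ⟶ TopCat.of W) :
    Hmap i (f ≫ g) = Hmap i f ≫ Hmap i g := by
  rw [Hmap, Functor.map_comp, HomologicalComplex.homologyMap_comp]

lemma Hmap_id (i : ℕ) (Y : Type) [TopologicalSpace Y] : Hmap i (𝟙 (TopCat.of Y)) = 𝟙 _ := by
  rw [Hmap, CategoryTheory.Functor.map_id, HomologicalComplex.homologyMap_id]

/-- Spaces with the same homotopy type have the same singular homology. -/
noncomputable def isoOfHomotopyEquiv (i : ℕ) {Y Z : Type} [TopologicalSpace Y]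
    [TopologicalSpace Z] (e : ContinuousMap.HomotopyEquiv Y Z) : H i Y ≅ H i Z where
  hom := Hmap i (TopCat.ofHom e.toFun)
  inv := Hmap i (TopCat.ofHom e.invFun)
  hom_inv_id := by
    rw [← Hmap_comp, ← Hmap_id]
    exact TopCat.Homotopy.congr_homologyMap_singularChainComplexFunctor
      e.left_inv.some _ i
  inv_hom_id := by
    rw [← Hmap_comp, ← Hmap_id]
    exact TopCat.Homotopy.congr_homologyMap_singularChainComplexFunctor
      e.right_inv.some _ i

/-- The translation of `ℝ × X` is homotopic to the identity. -/
lemma Hmap_shift (i : ℕ) (k : ℤ) : Hmap i (shift X k) = 𝟙 _ := by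
  rw [← Hmap_id]
  let F : TopCat.Homotopy (𝟙 (TopCat.of (ℝ × X))) (shift X k) :=
    { toFun := fun p => (p.2.1 + p.1 * k, p.2.2)
      continuous_toFun := by fun_prop
      map_zero_left := fun p => Prod.ext (by simp) rfl
      map_one_left := fun p => Prod.ext (by simp [shift]) rfl }
  exact (F.congr_homologyMap_singularChainComplexFunctor _ i).symm

/-- The first map of the exact sequence vanishes in homology, so that the long exact sequence breaks
up into short ones. -/
lemma homologyMap_chainSeq_f (i : ℕ) :
    HomologicalComplex.homologyMap (chainSeq X (ModuleCat.of ℤ ℤ)).f i = 0 := by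
  have h := HomologicalComplex.homologyMap_sub
    (((singularChainComplexFunctor (ModuleCat.{0} ℤ)).obj (ModuleCat.of ℤ ℤ)).map (shift X 1))
    (𝟙 _) i
  rw [HomologicalComplex.homologyMap_id] at h
  exact h.trans (sub_eq_zero.2 (Hmap_shift i 1))

/-- The factor `ℝ` does not change homology, as the line is contractible. -/
noncomputable def realProdIso (i : ℕ) : H i (ℝ × X) ≅ H i X :=
  isoOfHomotopyEquiv i <|
    ((ContractibleSpace.hequiv ℝ Unit).some.prodCongr (.refl X)).trans
      (Homeomorph.punitProd X).toHomotopyEquiv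

/-- In degree zero the circle factor does not change homology. -/
lemma nonempty_H_zero_iso : Nonempty (H 0 (UnitAddCircle × X) ≅ H 0 X) := by
  have hS := chainSeq_shortExact (X := X) (ModuleCat.of ℤ ℤ)
  have hm : Mono (Hmap 0 (proj X)) :=
    (hS.homology_exact₂ 0).mono_g (homologyMap_chainSeq_f 0)
  have he : Epi (Hmap 0 (proj X)) :=
    have : Epi ((chainSeq X (ModuleCat.of ℤ ℤ)).g.f 0) :=
      (hS.map_of_exact (HomologicalComplex.eval _ _ 0)).epi_g
    HomologicalComplex.epi_homologyMap_of_epi_of_not_rel (chainSeq X (ModuleCat.of ℤ ℤ)).g 0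
      (by simp)
  have : IsIso (Hmap 0 (proj X)) := isIso_of_mono_of_epi _
  exact ⟨(asIso (Hmap 0 (proj X))).symm ≪≫ realProdIso 0⟩

lemma nonempty_addEquiv_prod_of_exact {R A B C : Type*} [Ring R] [AddCommGroup A]
    [AddCommGroup B] [AddCommGroup C] [Module R A] [Module R B] [Module R C] [Module.Projective R C]
    {f : A →ₗ[R] B} {g : B →ₗ[R] C} (h : Function.Exact f g) (hf : Function.Injective f)
    (hg : Function.Surjective g) : Nonempty (B ≃+ A × C) := by
  obtain ⟨s, hs⟩ := Module.projective_lifting_property g LinearMap.id hg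
  exact ⟨(h.splitSurjectiveEquiv hf ⟨s, hs⟩).1.toAddEquiv⟩

/-- In positive degree the homology of the product with a circle is an extension; it splits as
soon as the quotient is free. -/
lemma nonempty_H_succ_addEquiv (i : ℕ) [Module.Free ℤ (H i X)] :
    Nonempty (H (i + 1) (UnitAddCircle × X) ≃+ H (i + 1) X × H i X) := by
  have hS := chainSeq_shortExact (X := X) (ModuleCat.of ℤ ℤ)
  have hm : Mono (Hmap (i + 1) (proj X)) :=
    (hS.homology_exact₂ (i + 1)).mono_g (homologyMap_chainSeq_f (i + 1))
  let δ : H (i + 1) (UnitAddCircle × X) ⟶ H i (ℝ × X) := hS.δ (i + 1) i rfl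
  have he : Epi δ := (hS.homology_exact₁ (i + 1) i rfl).epi_f (homologyMap_chainSeq_f i)
  have hex : (ShortComplex.mk (Hmap (i + 1) (proj X)) δ (hS.comp_δ (i + 1) i rfl)).Exact :=
    hS.homology_exact₃ (i + 1) i rfl
  have hfree : Module.Free ℤ (H i (ℝ × X)) :=
    Module.Free.of_equiv (realProdIso (X := X) i).symm.toLinearEquiv
  obtain ⟨e⟩ := nonempty_addEquiv_prod_of_exact
    ((ShortComplex.ShortExact.moduleCat_exact_iff_function_exact _).1 hex)
    ((ModuleCat.mono_iff_injective _).1 hm) ((ModuleCat.epi_iff_surjective _).1 he)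
  exact ⟨e.trans (AddEquiv.prodCongr (realProdIso (i + 1)).toLinearEquiv.toAddEquiv
    (realProdIso i).toLinearEquiv.toAddEquiv)⟩

/-- An additive equivalence of abelian groups is `ℤ`-linear for all module structures. -/
def intLinearEquiv {A B : Type*} [AddCommGroup A] [AddCommGroup B] [Module ℤ A] [Module ℤ B]
    (e : A ≃+ B) : A ≃ₗ[ℤ] B :=
  { e with map_smul' := fun c x => map_intCast_smul e ℤ ℤ c x }

/-- The homology of a discrete space is concentrated in degree zero. -/
lemma nonempty_H_discrete (L : Type) [TopologicalSpace L] [DiscreteTopology L] (i : ℕ) :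
    Nonempty (H i L ≃+ (L × Fin ((0 : ℕ).choose i) →₀ ℤ)) := by
  classical
  rcases i with _ | i
  · let e : H 0 L ≃ₗ[ℤ] DirectSum L fun _ => ℤ :=
      (singularHomologyFunctorZeroOfTotallyDisconnectedSpace (ModuleCat.{0} ℤ)
        (ModuleCat.of ℤ ℤ) (TopCat.of L) ≪≫
        ModuleCat.coprodIsoDirectSum fun _ : L => ModuleCat.of ℤ ℤ).toLinearEquiv
    exact ⟨e.toAddEquiv.trans <| (finsuppLEquivDirectSum ℤ ℤ L).symm.toAddEquiv.trans <|
      Finsupp.domCongr (Equiv.prodUnique L (Fin 1)).symm⟩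
  · have h := isZero_singularHomologyFunctor_of_totallyDisconnectedSpace (ModuleCat.{0} ℤ) (i + 1)
      (ModuleCat.of ℤ ℤ) (TopCat.of L) (Nat.succ_ne_zero i)
    have h1 : Subsingleton (H (i + 1) L) := ModuleCat.subsingleton_of_isZero h
    have h2 : IsEmpty (L × Fin ((0 : ℕ).choose (i + 1))) := by
      rw [Nat.choose_zero_succ]; infer_instance
    exact ⟨{ toFun := 0, invFun := 0, left_inv := fun _ => Subsingleton.elim _ _,
             right_inv := fun _ => Subsingleton.elim _ _,
             map_add' := fun _ _ => Subsingleton.elim _ _ }⟩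

/-- The homology of `Tⁿ × L` for a discrete space `L`, by induction on `n`; the ranks obey
Pascal's rule. -/
lemma nonempty_H_torus_prod (L : Type) [TopologicalSpace L] [DiscreteTopology L] (n i : ℕ) :
    Nonempty (H i ((Fin n → UnitAddCircle) × L) ≃+ (L × Fin (n.choose i) →₀ ℤ)) := by
  induction n generalizing i with
  | zero =>
    obtain ⟨e⟩ := nonempty_H_discrete L i
    exact ⟨(isoOfHomotopyEquiv i
      (Homeomorph.uniqueProd _ L).toHomotopyEquiv).toLinearEquiv.toAddEquiv.trans e⟩
  | succ n ih =>
    let h : ((Fin (n + 1) → UnitAddCircle) × L) ≃ₜ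
        (UnitAddCircle × ((Fin n → UnitAddCircle) × L)) :=
      ((Fin.consEquivL ℤ fun _ : Fin (n + 1) => UnitAddCircle).symm.toHomeomorph.prodCongr
        (.refl L)).trans (Homeomorph.prodAssoc _ _ _)
    let f (i : ℕ) := (isoOfHomotopyEquiv i h.toHomotopyEquiv).toLinearEquiv.toAddEquiv
    rcases i with _ | i
    · obtain ⟨e0⟩ := nonempty_H_zero_iso (X := (Fin n → UnitAddCircle) × L)
      obtain ⟨e⟩ := ih 0
      rw [Nat.choose_zero_right] at e ⊢
      exact ⟨((f 0).trans e0.toLinearEquiv.toAddEquiv).trans e⟩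
    · obtain ⟨e0⟩ := ih i
      obtain ⟨e1⟩ := ih (i + 1)
      have : Module.Free ℤ (H i ((Fin n → UnitAddCircle) × L)) :=
        Module.Free.of_equiv (intLinearEquiv e0).symm
      obtain ⟨e⟩ := nonempty_H_succ_addEquiv (X := (Fin n → UnitAddCircle) × L) i
      rw [Nat.choose_succ_succ, add_comm (n.choose i)]
      exact ⟨(((f (i + 1)).trans e).trans (e1.prodCongr e0)).trans <|
        Finsupp.sumFinsuppAddEquivProdFinsupp.symm.trans <| Finsupp.domCongr <|
          (Equiv.prodSumDistrib L _ _).symm.trans <| (Equiv.refl L).prodCongr finSumFinEquiv⟩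

/-- The free abelian group on `L × Fin b`, as a direct sum over `L`. -/
noncomputable def finsuppProdEquivDirectSum (L : Type) (b : ℕ) :
    (L × Fin b →₀ ℤ) ≃ₗ[ℤ] DirectSum L fun _ => (Fin b → ℤ) := by
  classical
  exact (Finsupp.curryLinearEquiv ℤ).trans <|
    (Finsupp.mapRange.linearEquiv (Finsupp.linearEquivFunOnFinite ℤ ℤ (Fin b))).trans <|
    finsuppLEquivDirectSum ℤ (Fin b → ℤ) L

end CircleProd

namespace FloerBott

open CategoryTheory

/-- The Bott-type Floer cohomology, when the critical points of action at most `a` form a disjoint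
union of tori indexed by the discrete space `L`. -/
lemma floerCohomology_of_homeomorph {n : ℕ} {a : ℝ} {L : Type} [TopologicalSpace L]
    [DiscreteTopology L] (h : critBelow n a ≃ₜ Torus n × L) :
    (∀ i : ℕ, i ≤ n → Nonempty
      (floerCohomology n a (-(i : ℤ)) ≃ₗ[ℤ] DirectSum L fun _ => (Fin (n.choose i) → ℤ))) ∧
    ∀ m : ℤ, (m < -(n : ℤ) ∨ 0 < m) → Subsingleton (floerCohomology n a m) := by
  have key (i : ℕ) : Nonempty (floerCohomology n a (-(i : ℤ)) ≃ₗ[ℤ]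
      DirectSum L fun _ => (Fin (n.choose i) → ℤ)) := by
    obtain ⟨e⟩ := CircleProd.nonempty_H_torus_prod L n i
    let e1 : floerCohomology n a (-(i : ℤ)) ≃ₗ[ℤ] CircleProd.H i (critBelow n a) :=
      (HomologicalComplex.extendHomologyIso
        (((AlgebraicTopology.singularChainComplexFunctor (ModuleCat.{0} ℤ)).obj
        (ModuleCat.of ℤ ℤ)).obj (TopCat.of (critBelow n a))) ComplexShape.embeddingDownNat
        (j := i) rfl).toLinearEquiv
    let e2 := (CircleProd.isoOfHomotopyEquiv i h.toHomotopyEquiv).toLinearEquiv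
    exact ⟨(e1.trans e2).trans ((CircleProd.intLinearEquiv e).trans
      (CircleProd.finsuppProdEquivDirectSum L _))⟩
  refine ⟨fun i _ => key i, fun m hm => ?_⟩
  rcases hm with hm | hm
  · obtain ⟨i, rfl⟩ : ∃ i : ℕ, m = -(i : ℤ) := ⟨m.natAbs, by lia⟩
    obtain ⟨e⟩ := key i
    have : IsEmpty (Fin (n.choose i)) := by
      rw [Nat.choose_eq_zero_of_lt (by lia)]; infer_instance
    exact e.toEquiv.subsingleton
  · refine ModuleCat.subsingleton_of_isZero ?_
    refine ShortComplex.isZero_homology_of_isZero_X₂ _ ?_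
    refine HomologicalComplex.isZero_extend_X _ _ _ fun i hi => ?_
    simp at hi
    lia

end FloerBott

/-! ### Square-integrable functions on the circle and weak derivatives -/

namespace CircleL2

open MeasureTheory Complex
open scoped ContDiff ENNReal ComplexConjugate

/-- `L²(ℝ/ℤ, ℂ)`. -/
abbrev L2C : Type := Lp ℂ 2 (volume : Measure UnitAddCircle)

/-- Weak derivatives of square-integrable maps from the circle to a real normed space, tested
against smooth real functions. -/
def WeakDeriv {E : Type*} [NormedAddCommGroup E] [NormedSpace ℝ E]
    (f w : Lp E 2 (volume : Measure UnitAddCircle)) : Prop :=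
  ∀ φ ψ : UnitAddCircle → ℝ, ContDiff ℝ ∞ (fun t : ℝ => φ t) →
    (∀ t : ℝ, HasDerivAt (fun s : ℝ => φ s) (ψ t) t) →
    ∫ t, ψ t • f t = -∫ t, φ t • w t

/-- `φ` is a smooth function on the circle with derivative `ψ`. -/
structure IsSmoothPair {E : Type*} [NormedAddCommGroup E] [NormedSpace ℝ E]
    (φ ψ : UnitAddCircle → E) : Prop where
  contDiff : ContDiff ℝ ∞ (fun t : ℝ => φ t)
  hasDerivAt : ∀ t : ℝ, HasDerivAt (fun s : ℝ => φ s) (ψ t) t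

section smooth

variable {E F : Type*} [NormedAddCommGroup E] [NormedSpace ℝ E] [NormedAddCommGroup F]
  [NormedSpace ℝ F]

lemma continuous_of_lift {X : Type*} [TopologicalSpace X] {φ : UnitAddCircle → X}
    (h : Continuous fun t : ℝ => φ t) : Continuous φ :=
  (isQuotientMap_quotient_mk' (s := QuotientAddGroup.leftRel _)).continuous_iff.2 h

lemma IsSmoothPair.continuous_left {φ ψ : UnitAddCircle → E} (h : IsSmoothPair φ ψ) :
    Continuous φ :=
  continuous_of_lift h.contDiff.continuous

lemma IsSmoothPair.continuous_right {φ ψ : UnitAddCircle → E} (h : IsSmoothPair φ ψ) :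
    Continuous ψ := by
  refine continuous_of_lift ?_
  have : (fun t : ℝ => ψ t) = deriv fun s : ℝ => φ s := funext fun t => (h.hasDerivAt t).deriv.symm
  rw [this]
  exact h.contDiff.continuous_deriv (by simp)

lemma IsSmoothPair.clm {φ ψ : UnitAddCircle → E} (h : IsSmoothPair φ ψ) (L : E →L[ℝ] F) :
    IsSmoothPair (fun t => L (φ t)) (fun t => L (ψ t)) :=
  ⟨L.contDiff.comp h.contDiff, fun t => L.hasFDerivAt.comp_hasDerivAt t (h.hasDerivAt t)⟩

lemma IsSmoothPair.mul {φ ψ φ' ψ' : UnitAddCircle → ℂ} (h : IsSmoothPair φ ψ)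
    (h' : IsSmoothPair φ' ψ') :
    IsSmoothPair (fun t => φ t * φ' t) (fun t => ψ t * φ' t + φ t * ψ' t) :=
  ⟨h.contDiff.mul h'.contDiff, fun t => (h.hasDerivAt t).mul (h'.hasDerivAt t)⟩

lemma isSmoothPair_fourier (m : ℤ) :
    IsSmoothPair (fun t : UnitAddCircle => fourier m t)
      (fun t : UnitAddCircle => 2 * Real.pi * I * m * fourier m t) := by
  constructor
  · have : (fun t : ℝ => fourier m (t : UnitAddCircle)) =
        fun t : ℝ => Complex.exp (2 * Real.pi * I * m * t / (1 : ℝ)) :=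
      funext fun t => fourier_coe_apply
    rw [this]
    exact Complex.contDiff_exp.comp
      ((contDiff_const.mul ofRealCLM.contDiff).div_const _)
  · intro t
    simpa using hasDerivAt_fourier (T := 1) m t

end smooth

lemma integrable_mul {φ : UnitAddCircle → ℂ} (hφ : Continuous φ) {F : UnitAddCircle → ℂ}
    (hF : Integrable F) : Integrable fun t => φ t * F t := by
  obtain ⟨C, hC⟩ := isCompact_univ.exists_bound_of_continuousOn hφ.continuousOn
  exact hF.bdd_mul (c := C) hφ.aestronglyMeasurable
    (Filter.Eventually.of_forall fun t => hC t trivial)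

lemma integral_mul_add {φ χ : UnitAddCircle → ℂ} (hφ : Continuous φ) (hχ : Continuous χ)
    {F G : UnitAddCircle → ℂ} (hF : Integrable F) (hG : Integrable G) :
    ∫ t, (φ t * F t + χ t * G t) = (∫ t, φ t * F t) + ∫ t, χ t * G t :=
  integral_add (integrable_mul hφ hF) (integrable_mul hχ hG)

lemma integrable_mul_L2 (f g : Lp ℂ 2 (volume : Measure UnitAddCircle)) :
    Integrable fun t => f t * g t :=
  (Lp.memLp f).integrable_mul (Lp.memLp g)

lemma integrable_L2 {E : Type*} [NormedAddCommGroup E]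
    (f : Lp E 2 (volume : Measure UnitAddCircle)) : Integrable f :=
  (Lp.memLp f).integrable (by norm_num)

/-- A weak derivative may be tested against complex-valued smooth functions. -/
lemma WeakDeriv.integral_mul {f w : L2C} (h : WeakDeriv f w) {φ ψ : UnitAddCircle → ℂ}
    (hφ : IsSmoothPair φ ψ) : ∫ t, ψ t * f t = -∫ t, φ t * w t := by
  have hre := h (fun t => reCLM (φ t)) (fun t => reCLM (ψ t)) (hφ.clm reCLM).contDiff
    (hφ.clm reCLM).hasDerivAt
  have him := h (fun t => imCLM (φ t)) (fun t => imCLM (ψ t)) (hφ.clm imCLM).contDiff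
    (hφ.clm imCLM).hasDerivAt
  have key (θ : UnitAddCircle → ℂ) (hθ : Continuous θ) (F : L2C) :
      ∫ t, θ t * F t = (∫ t, (reCLM (θ t)) • F t) + I * ∫ t, (imCLM (θ t)) • F t := by
    have h1 (L : ℂ →L[ℝ] ℝ) : Integrable fun t => L (θ t) • F t := by
      have := integrable_mul (φ := fun t => ((L (θ t) : ℝ) : ℂ))
        (by fun_prop) (integrable_L2 F)
      simpa only [real_smul] using this
    rw [← integral_const_mul, ← integral_add (h1 _) ((h1 _).const_mul I)]
    refine integral_congr_ae (Filter.Eventually.of_forall fun t => ?_)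
    simp only [reCLM_apply, imCLM_apply, real_smul]
    conv_lhs => rw [← re_add_im (θ t)]
    ring
  rw [key _ hφ.continuous_right, key _ hφ.continuous_left, hre, him]
  ring

lemma weakDeriv_iff {f w : L2C} : WeakDeriv f w ↔ ∀ φ ψ : UnitAddCircle → ℂ,
    IsSmoothPair φ ψ → ∫ t, ψ t * f t = -∫ t, φ t * w t := by
  refine ⟨fun h φ ψ hφ => h.integral_mul hφ, fun h φ ψ h1 h2 => ?_⟩
  have := h _ _ ((IsSmoothPair.mk h1 h2).clm ofRealCLM)
  simpa using this

lemma integral_smul_compLp {E F : Type*} [NormedAddCommGroup E] [NormedSpace ℝ E]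
    [NormedAddCommGroup F] [NormedSpace ℝ F] [CompleteSpace E] [CompleteSpace F] (L : E →L[ℝ] F)
    {θ : UnitAddCircle → ℝ} (hθ : Continuous θ) (f : Lp E 2 (volume : Measure UnitAddCircle)) :
    ∫ t, θ t • (L.compLp f) t = L (∫ t, θ t • f t) := by
  obtain ⟨C, hC⟩ := isCompact_univ.exists_bound_of_continuousOn hθ.continuousOn
  have hi : Integrable fun t => θ t • f t :=
    (integrable_L2 f).bdd_smul C hθ.aestronglyMeasurable
      (Filter.Eventually.of_forall fun t => hC t trivial)
  rw [← L.integral_comp_comm hi]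
  refine integral_congr_ae ?_
  filter_upwards [L.coeFn_compLp f] with t ht
  rw [ht, map_smul]

lemma WeakDeriv.clm {E F : Type*} [NormedAddCommGroup E] [NormedSpace ℝ E] [NormedAddCommGroup F]
    [NormedSpace ℝ F] [CompleteSpace E] [CompleteSpace F] (L : E →L[ℝ] F)
    {f w : Lp E 2 (volume : Measure UnitAddCircle)} (h : WeakDeriv f w) :
    WeakDeriv (L.compLp f) (L.compLp w) := by
  intro φ ψ h1 h2
  have hs := IsSmoothPair.mk h1 h2
  rw [integral_smul_compLp L hs.continuous_right, integral_smul_compLp L hs.continuous_left,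
    h φ ψ h1 h2, map_neg]

lemma WeakDeriv.add {f w f' w' : L2C} (h : WeakDeriv f w) (h' : WeakDeriv f' w') :
    WeakDeriv (f + f') (w + w') := by
  rw [weakDeriv_iff] at *
  intro φ ψ hφ
  have key (θ : UnitAddCircle → ℂ) (hθ : Continuous θ) (f f' : L2C) :
      ∫ t, θ t * (f + f') t = (∫ t, θ t * f t) + ∫ t, θ t * f' t := by
    rw [← integral_add (integrable_mul hθ (integrable_L2 f)) (integrable_mul hθ (integrable_L2 f'))]
    refine integral_congr_ae ?_
    filter_upwards [Lp.coeFn_add f f'] with t ht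
    rw [ht, Pi.add_apply, mul_add]
  rw [key _ hφ.continuous_right, key _ hφ.continuous_left, h φ ψ hφ, h' φ ψ hφ]
  ring

/-- Multiplication of a square-integrable function by a continuous one. -/
noncomputable def mulL : C(UnitAddCircle, ℂ) →L[ℂ] L2C →L[ℂ] L2C :=
  ((ContinuousLinearMap.mul ℂ ℂ).holderL volume ∞ 2 2).comp (ContinuousMap.toLp ∞ volume ℂ)

lemma coeFn_mulL (θ : C(UnitAddCircle, ℂ)) (f : L2C) : mulL θ f =ᵐ[volume] fun t => θ t * f t := by
  have h1 := (ContinuousLinearMap.mul ℂ ℂ).coeFn_holder (r := 2)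
    (ContinuousMap.toLp ∞ (volume : Measure UnitAddCircle) ℂ θ) f
  filter_upwards [h1, ContinuousMap.coeFn_toLp (p := ∞) (𝕜 := ℂ)
    (volume : Measure UnitAddCircle) θ] with t h1 h2
  refine h1.trans ?_
  rw [h2]; rfl

/-- The bilinear pairing `∫ f g`. -/
noncomputable def pairing : L2C →L[ℂ] L2C →L[ℂ] ℂ :=
  (ContinuousLinearMap.mul ℂ ℂ).lpPairing volume 2 2

lemma pairing_apply (f g : L2C) : pairing f g = ∫ t, f t * g t :=
  ContinuousLinearMap.lpPairing_eq_integral _ f g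

/-- Pointwise complex conjugation. -/
noncomputable def conjL : L2C →L[ℝ] L2C :=
  (conjCLE : ℂ →L[ℝ] ℂ).compLpL 2 volume

lemma coeFn_conjL (f : L2C) : conjL f =ᵐ[volume] fun t => conj (f t) :=
  (conjCLE : ℂ →L[ℝ] ℂ).coeFn_compLp f

lemma WeakDeriv.conj {f w : L2C} (h : WeakDeriv f w) : WeakDeriv (conjL f) (conjL w) :=
  h.clm _

lemma inner_eq_pairing (f g : L2C) : inner ℂ f g = pairing (conjL f) g := by
  rw [L2.inner_def, pairing_apply]
  refine integral_congr_ae ?_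
  filter_upwards [coeFn_conjL f] with t ht
  rw [ht, mul_comm]; rfl

/-- The Leibniz rule for the product with a smooth function. -/
lemma WeakDeriv.leibniz {f w : L2C} (h : WeakDeriv f w) {θ η : C(UnitAddCircle, ℂ)}
    (hθ : IsSmoothPair θ η) : WeakDeriv (mulL θ f) (mulL θ w + mulL η f) := by
  rw [weakDeriv_iff]
  intro φ ψ hφ
  have hc1 := hφ.continuous_left
  have hc2 := hφ.continuous_right
  have h0 := h.integral_mul (hφ.mul hθ)
  have e1 : ∫ t, φ t * (mulL θ w + mulL η f) t =
      (∫ t, (φ t * θ t) * w t) + ∫ t, (φ t * η t) * f t := by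
    rw [← integral_mul_add (by fun_prop) (by fun_prop) (integrable_L2 w) (integrable_L2 f)]
    refine integral_congr_ae ?_
    filter_upwards [Lp.coeFn_add (mulL θ w) (mulL η f), coeFn_mulL θ w,
      coeFn_mulL η f] with t h1 h2 h3
    rw [h1, Pi.add_apply, h2, h3]; ring
  have e2 : ∫ t, ψ t * (mulL θ f) t = ∫ t, (ψ t * θ t) * f t := by
    refine integral_congr_ae ?_
    filter_upwards [coeFn_mulL θ f] with t h1
    rw [h1]; ring
  have e3 : ∫ t, (ψ t * θ t + φ t * η t) * f t =
      (∫ t, (ψ t * θ t) * f t) + ∫ t, (φ t * η t) * f t := by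
    rw [← integral_mul_add (by fun_prop) (by fun_prop) (integrable_L2 f) (integrable_L2 f)]
    refine integral_congr_ae (Filter.Eventually.of_forall fun t => ?_)
    ring
  rw [e1, e2]
  rw [e3] at h0
  linear_combination h0

/-! ### Fourier series -/

lemma volume_eq_haarAddCircle :
    (volume : Measure UnitAddCircle) = AddCircle.haarAddCircle (T := (1 : ℝ)) := by
  rw [AddCircle.volume_eq_smul_haarAddCircle, ENNReal.ofReal_one, one_smul]

/-- The character `e^{2πimt}` as a square-integrable function. -/
noncomputable def e (m : ℤ) : L2C := ContinuousMap.toLp 2 volume ℂ (fourier m)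

lemma coeFn_e (m : ℤ) : e m =ᵐ[volume] fun t => fourier m t :=
  ContinuousMap.coeFn_toLp (p := 2) (𝕜 := ℂ) (volume : Measure UnitAddCircle) _

/-- Mathlib states the completeness of the Fourier basis for the normalized Haar measure, which is
the volume on the circle of length one. -/
lemma exists_hilbertBasis : ∃ b : HilbertBasis ℤ ℂ L2C, ∀ m, b m = e m := by
  have key (μ : Measure UnitAddCircle) [IsFiniteMeasure μ]
      (hμ : μ = AddCircle.haarAddCircle (T := (1 : ℝ))) :
      ∃ b : HilbertBasis ℤ ℂ (Lp ℂ 2 μ), ∀ m, b m = ContinuousMap.toLp 2 μ ℂ (fourier m) := by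
    subst hμ
    exact ⟨fourierBasis, fun m => congrFun coe_fourierBasis m⟩
  exact key _ volume_eq_haarAddCircle

lemma orthonormal_e : Orthonormal ℂ e := by
  obtain ⟨b, hb⟩ := exists_hilbertBasis
  rw [← funext hb]
  exact b.orthonormal

lemma hasSum_e (f : L2C) : HasSum (fun m => inner ℂ (e m) f • e m) f := by
  obtain ⟨b, hb⟩ := exists_hilbertBasis
  have := b.hasSum_repr f
  simpa only [b.repr_apply_apply, hb] using this

lemma inner_e (m : ℤ) (f : L2C) : inner ℂ (e m) f = ∫ t, fourier (-m) t * f t := by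
  rw [L2.inner_def]
  refine integral_congr_ae ?_
  filter_upwards [coeFn_e m] with t ht
  rw [ht, fourier_neg, mul_comm]; rfl

lemma eq_zero_of_inner_e {f : L2C} (h : ∀ m, inner ℂ (e m) f = 0) : f = 0 := by
  have := hasSum_e f
  simp only [h, zero_smul] at this
  exact this.unique hasSum_zero

/-- The Fourier coefficients of a weak derivative. -/
lemma WeakDeriv.inner_e_eq {f w : L2C} (h : WeakDeriv f w) (m : ℤ) :
    inner ℂ (e m) w = 2 * Real.pi * I * m * inner ℂ (e m) f := by
  have := h.integral_mul (isSmoothPair_fourier (-m))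
  rw [inner_e, inner_e]
  simp only [mul_assoc, integral_const_mul] at this ⊢
  push_cast at this
  linear_combination this

lemma WeakDeriv.unique {f w w' : L2C} (h : WeakDeriv f w) (h' : WeakDeriv f w') : w = w' := by
  rw [← sub_eq_zero]
  refine eq_zero_of_inner_e fun m => ?_
  rw [inner_sub_right, h.inner_e_eq, h'.inner_e_eq, sub_self]

lemma IsSmoothPair.integral_eq_zero {φ ψ : UnitAddCircle → ℂ} (h : IsSmoothPair φ ψ) :
    ∫ t, ψ t = 0 := by
  rw [← UnitAddCircle.intervalIntegral_preimage 0 ψ,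
    intervalIntegral.integral_eq_sub_of_hasDerivAt (fun t _ => h.hasDerivAt t)
      ((h.continuous_right.comp (AddCircle.continuous_mk' 1)).intervalIntegrable _ _),
    sub_eq_zero, zero_add]
  congr 1
  exact AddCircle.coe_period 1

lemma weakDeriv_e (m : ℤ) : WeakDeriv (e m) ((2 * Real.pi * I * m : ℂ) • e m) := by
  rw [weakDeriv_iff]
  intro φ ψ hφ
  have hc1 := hφ.continuous_left
  have hc2 := hφ.continuous_right
  have h0 := (hφ.mul (isSmoothPair_fourier m)).integral_eq_zero
  have hi (χ : UnitAddCircle → ℂ) (hχ : Continuous χ) : Integrable χ := by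
    simpa using integrable_mul hχ (integrable_const (μ := volume) (1 : ℂ))
  rw [integral_add (hi _ (by fun_prop)) (hi _ (by fun_prop))] at h0
  rw [integral_congr_ae (g := fun t => ψ t * fourier m t),
    integral_congr_ae (g := fun t => φ t * (2 * Real.pi * I * m * fourier m t))
      (f := fun t => φ t * ((2 * Real.pi * I * m : ℂ) • e m) t)]
  · linear_combination h0
  · filter_upwards [coeFn_e m, Lp.coeFn_smul (2 * Real.pi * I * m : ℂ) (e m)] with t h1 h2
    rw [h2, Pi.smul_apply, h1, smul_eq_mul]
  · filter_upwards [coeFn_e m] with t h1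
    rw [h1]

lemma mulL_pairing_e (θ : C(UnitAddCircle, ℂ)) (f : L2C) (m : ℤ) :
    pairing (mulL θ f) (e m) = ∫ t, (θ t * fourier m t) * f t := by
  rw [pairing_apply]
  refine integral_congr_ae ?_
  filter_upwards [coeFn_mulL θ f, coeFn_e m] with t h1 h2
  rw [h1, h2]; ring

/-- The Leibniz rule for a product of two weakly differentiable functions, tested against a smooth
function `θ` with derivative `η`. When the second factor is a character, this is the definition
of the weak derivative; the general case follows by expansion in a Fourier series. -/
lemma WeakDeriv.pairing_mulL {f w a b : L2C} (h : WeakDeriv f w) (h' : WeakDeriv a b)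
    {θ η : C(UnitAddCircle, ℂ)} (hθ : IsSmoothPair θ η) :
    pairing (mulL η f) a =
      -pairing (mulL θ w) a - pairing (mulL θ f) b := by
  have hm (m : ℤ) : pairing (mulL η f) (e m) = -pairing (mulL θ w) (e m) -
      pairing (mulL θ f) ((2 * Real.pi * I * m : ℂ) • e m) := by
    have h0 := h.integral_mul (hθ.mul (isSmoothPair_fourier m))
    rw [map_smul, mulL_pairing_e, mulL_pairing_e, mulL_pairing_e, smul_eq_mul, ← integral_const_mul]
    have e1 : ∫ t, (η t * fourier m t + θ t * (2 * Real.pi * I * m * fourier m t)) * f t =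
        (∫ t, (η t * fourier m t) * f t) +
          ∫ t, (2 * Real.pi * I * m) * ((θ t * fourier m t) * f t) := by
      rw [← integral_add (integrable_mul (by fun_prop) (integrable_L2 f))
        ((integrable_mul (by fun_prop) (integrable_L2 f)).const_mul _)]
      refine integral_congr_ae (Filter.Eventually.of_forall fun t => ?_)
      ring
    rw [e1] at h0
    linear_combination h0
  have ha := hasSum_e a
  have hb : HasSum (fun m : ℤ => inner ℂ (e m) a • (2 * Real.pi * I * m : ℂ) • e m) b := by
    have := hasSum_e b
    simp only [h'.inner_e_eq] at this
    simpa only [smul_smul, mul_comm] using this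
  have s1 := ha.mapL (pairing (mulL η f))
  have s2 := (ha.mapL (pairing (mulL θ w))).neg.sub (hb.mapL (pairing (mulL θ f)))
  refine s1.unique (Eq.subst (motive := fun F => HasSum F _) (funext fun m => ?_) s2)
  rw [map_smul _ _ (e m), map_smul _ _ (e m), hm, map_smul _ (inner ℂ (e m) a)]
  simp only [smul_eq_mul]
  ring

end CircleL2

/-! ### Functions of modulus one -/

namespace CircleL2

open MeasureTheory Complex
open scoped ContDiff ENNReal ComplexConjugate

lemma WeakDeriv.const_smul {f w : L2C} (h : WeakDeriv f w) (c : ℂ) :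
    WeakDeriv (c • f) (c • w) := by
  rw [weakDeriv_iff] at *
  intro φ ψ hφ
  have key (θ : UnitAddCircle → ℂ) (f : L2C) : ∫ t, θ t * (c • f) t = c * ∫ t, θ t * f t := by
    rw [← integral_const_mul]
    refine integral_congr_ae ?_
    filter_upwards [Lp.coeFn_smul c f] with t ht
    rw [ht, Pi.smul_apply, smul_eq_mul]; ring
  rw [key, key, h φ ψ hφ, mul_neg]

/-- The fundamental lemma of the calculus of variations, for real-valued functions. -/
lemma eq_zero_of_integral_smooth {f : L2C} (him : ∀ᵐ t, (f t).im = 0)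
    (h : ∀ φ ψ : UnitAddCircle → ℝ, IsSmoothPair φ ψ → (∫ t, (φ t : ℂ) * f t).re = 0) :
    f = 0 := by
  have h0 (φ ψ : UnitAddCircle → ℝ) (hφ : IsSmoothPair φ ψ) : ∫ t, (φ t : ℂ) * f t = 0 := by
    have hc := hφ.continuous_left
    refine Complex.ext (h φ ψ hφ) ?_
    have hi : Integrable fun t => (φ t : ℂ) * f t :=
      integrable_mul (by fun_prop) (integrable_L2 f)
    rw [zero_im, ← imCLM_apply, ← imCLM.integral_comp_comm hi]
    refine integral_eq_zero_of_ae ?_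
    filter_upwards [him] with t ht
    simp [ht]
  refine eq_zero_of_inner_e fun m => ?_
  have hs := isSmoothPair_fourier (-m)
  have h1 := h0 _ _ (hs.clm reCLM)
  have h2 := h0 _ _ (hs.clm imCLM)
  simp only [reCLM_apply, imCLM_apply] at h1 h2
  have hc := hs.continuous_left
  have e1 : inner ℂ (e m) f = (∫ t, ((fourier (-m) t).re : ℂ) * f t) +
      I * ∫ t, ((fourier (-m) t).im : ℂ) * f t := by
    rw [inner_e, ← integral_const_mul, ← integral_add
      (integrable_mul (by fun_prop) (integrable_L2 f))
      ((integrable_mul (by fun_prop) (integrable_L2 f)).const_mul _)]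
    refine integral_congr_ae (Filter.Eventually.of_forall fun t => ?_)
    beta_reduce
    conv_lhs => rw [← re_add_im (fourier (-m) t)]
    ring
  rw [e1, h1, h2, mul_zero, add_zero]

/-- The product with a function of modulus one is square-integrable. -/
lemma exists_mul {x : L2C} (hx : ∀ᵐ t, ‖x t‖ = 1) (f : L2C) :
    ∃ F : L2C, F =ᵐ[volume] fun t => x t * f t := by
  have : MemLp (fun t => x t * f t) 2 volume := by
    refine (Lp.memLp f).of_le ((Lp.aestronglyMeasurable x).mul (Lp.aestronglyMeasurable f)) ?_
    filter_upwards [hx] with t ht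
    rw [norm_mul, ht, one_mul]
  exact ⟨this.toLp, this.coeFn_toLp⟩

lemma norm_conjL_eq_one {x : L2C} (hx : ∀ᵐ t, ‖x t‖ = 1) : ∀ᵐ t, ‖conjL x t‖ = 1 := by
  filter_upwards [hx, coeFn_conjL x] with t h1 h2
  rw [h2, RCLike.norm_conj, h1]

/-- A weakly differentiable function of constant modulus has velocity orthogonal to it. -/
lemma WeakDeriv.re_conj_mul_eq_zero {x g : L2C} (h : WeakDeriv x g) (hx : ∀ᵐ t, ‖x t‖ = 1) :
    ∀ᵐ t, (conj (x t) * g t).re = 0 := by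
  obtain ⟨P, hP⟩ := exists_mul (norm_conjL_eq_one hx) g
  -- `P = conj x · x'`, and twice its real part is the derivative of the constant `|x|²`.
  have hP' : P + conjL P = 0 := by
    refine eq_zero_of_integral_smooth ?_ fun φ ψ hφ => ?_
    · filter_upwards [Lp.coeFn_add P (conjL P), coeFn_conjL P] with t h1 h2
      rw [h1, Pi.add_apply, h2, add_im, conj_im, add_neg_cancel]
    · have hc1 := hφ.continuous_left
      have hc2 := hφ.continuous_right
      let θ : C(UnitAddCircle, ℂ) := ⟨fun t => φ t, by fun_prop⟩
      let η : C(UnitAddCircle, ℂ) := ⟨fun t => ψ t, by fun_prop⟩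
      have hs : IsSmoothPair θ η := hφ.clm ofRealCLM
      have key := h.pairing_mulL h.conj hs
      have e0 : pairing (mulL η x) (conjL x) = 0 := by
        rw [pairing_apply, ← hs.integral_eq_zero]
        refine integral_congr_ae ?_
        filter_upwards [coeFn_mulL η x, coeFn_conjL x, hx] with t h1 h2 h3
        rw [h1, h2, mul_assoc, mul_conj, normSq_eq_norm_sq, h3]
        simp
      have e1 : ∫ t, (φ t : ℂ) * (P + conjL P) t =
          pairing (mulL θ g) (conjL x) +
            pairing (mulL θ x) (conjL g) := by
        rw [pairing_apply, pairing_apply,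
          ← integral_add (integrable_mul_L2 _ _) (integrable_mul_L2 _ _)]
        refine integral_congr_ae ?_
        filter_upwards [Lp.coeFn_add P (conjL P), coeFn_conjL P, hP, coeFn_mulL θ g,
          coeFn_mulL θ x, coeFn_conjL x, coeFn_conjL g] with t h1 h2 h3 h4 h5 h6 h7
        rw [h1, Pi.add_apply, h2, h3, h4, h5, h6, h7, map_mul, conj_conj]
        change (φ t : ℂ) * _ = (φ t : ℂ) * _ * _ + (φ t : ℂ) * _ * _
        ring
      rw [e1]
      rw [e0] at key
      have : pairing (mulL θ g) (conjL x) +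
            pairing (mulL θ x) (conjL g) = 0 := by linear_combination key
      rw [this, zero_re]
  filter_upwards [hP, coeFn_conjL x, Lp.coeFn_add P (conjL P), coeFn_conjL P,
    Lp.coeFn_zero ℂ 2 (volume : Measure UnitAddCircle)] with t h1 h2 h3 h4 h5
  rw [hP', h5, Pi.add_apply, h4, h1, h2] at h3
  have := congrArg re h3
  simp only [Pi.zero_apply, zero_re, add_re, conj_re] at this
  linarith

/-! ### The one-dimensional variational problem -/

/-- Quadruples `(x, x', y, y')`: one coordinate `(x, y)` of a loop in `ℂⁿ × (ℂⁿ)*`, with its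
derivative. -/
abbrev Quad : Type := L2C × L2C × L2C × L2C

/-- The quadruple is a weakly differentiable loop in `T*S¹ ⊂ ℂ × ℂ*`. -/
structure Quad.IsLoop (k : Quad) : Prop where
  weakDeriv_fst : WeakDeriv k.1 k.2.1
  weakDeriv_snd : WeakDeriv k.2.2.1 k.2.2.2
  norm_eq_one : ∀ᵐ t, ‖k.1 t‖ = 1
  re_mul_eq_zero : ∀ᵐ t, (k.1 t * k.2.2.1 t).re = 0

/-- The symplectic action of a loop in `T*S¹`. -/
noncomputable def Quad.act (k : Quad) : ℝ := (pairing k.2.2.1 k.2.1).re - ‖k.2.2.1‖ ^ 2 / 2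

/-- Critical points of the symplectic action of `T*S¹`. -/
def Quad.IsCrit (k : Quad) : Prop :=
  k.IsLoop ∧ ∀ c : ℝ → Quad, (∀ s, (c s).IsLoop) → c 0 = k →
    DifferentiableAt ℝ c 0 → HasDerivAt (fun s => (c s).act) 0 0

lemma norm_sq_eq_pairing (f : L2C) : ‖f‖ ^ 2 = (pairing (conjL f) f).re := by
  rw [← inner_eq_pairing, inner_self_eq_norm_sq_to_K]
  norm_cast

lemma norm_sq_eq_integral (f : L2C) : ‖f‖ ^ 2 = ∫ t, ‖f t‖ ^ 2 := by
  rw [norm_sq_eq_pairing, pairing_apply, ← reCLM_apply,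
    ← reCLM.integral_comp_comm (integrable_mul_L2 _ _)]
  refine integral_congr_ae ?_
  filter_upwards [coeFn_conjL f] with t ht
  rw [reCLM_apply, ht, mul_comm, mul_conj, ofReal_re, normSq_eq_norm_sq]

lemma re_pairing_conjL_comm (f g : L2C) :
    (pairing (conjL f) g).re = (pairing (conjL g) f).re := by
  rw [← inner_eq_pairing, ← inner_eq_pairing, ← inner_conj_symm, conj_re]

/-- The differential of the action along a curve. -/
lemma Quad.hasDerivAt_act {c : ℝ → Quad} {k' : Quad} (hc : HasDerivAt c k' 0) :
    HasDerivAt (fun s => (c s).act)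
      (pairing k'.2.2.1 (c 0).2.1 + pairing (c 0).2.2.1 k'.2.1 -
        pairing (conjL (c 0).2.2.1) k'.2.2.1).re 0 := by
  let pg : Quad →L[ℝ] L2C := (ContinuousLinearMap.fst ℝ _ _).comp (ContinuousLinearMap.snd ℝ _ _)
  let py : Quad →L[ℝ] L2C := (ContinuousLinearMap.fst ℝ _ _).comp
    ((ContinuousLinearMap.snd ℝ _ _).comp (ContinuousLinearMap.snd ℝ _ _))
  have hg : HasDerivAt (fun s => (c s).2.1) k'.2.1 0 := pg.hasFDerivAt.comp_hasDerivAt (0 : ℝ) hc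
  have hy : HasDerivAt (fun s => (c s).2.2.1) k'.2.2.1 0 :=
    py.hasFDerivAt.comp_hasDerivAt (0 : ℝ) hc
  let B : L2C →L[ℝ] L2C →L[ℝ] ℂ := pairing.bilinearRestrictScalars ℝ
  have h1 := (B.hasFDerivAt.comp_hasDerivAt (0 : ℝ) hy).clm_apply hg
  have h2 := (B.hasFDerivAt.comp_hasDerivAt (0 : ℝ)
    (conjL.hasFDerivAt.comp_hasDerivAt (0 : ℝ) hy)).clm_apply hy
  have h3 := (reCLM.hasFDerivAt.comp_hasDerivAt (0 : ℝ) h1).sub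
    ((reCLM.hasFDerivAt.comp_hasDerivAt (0 : ℝ) h2).div_const 2)
  have hf : (fun s => (c s).act) = fun s => (pairing (c s).2.2.1 (c s).2.1).re -
      (pairing (conjL (c s).2.2.1) (c s).2.2.1).re / 2 := by
    funext s
    rw [← norm_sq_eq_pairing]; rfl
  rw [hf]
  refine h3.congr_deriv ?_
  change (pairing k'.2.2.1 (c 0).2.1 + pairing (c 0).2.2.1 k'.2.1).re -
    (pairing (conjL k'.2.2.1) (c 0).2.2.1 + pairing (conjL (c 0).2.2.1) k'.2.2.1).re / 2 = _
  simp only [add_re, sub_re, re_pairing_conjL_comm k'.2.2.1]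
  ring

/-- The Euler–Lagrange equation in weak form. -/
lemma Quad.IsCrit.differential_eq_zero {k : Quad} (hk : k.IsCrit) {c : ℝ → Quad} {k' : Quad}
    (hl : ∀ s, (c s).IsLoop) (h0 : c 0 = k) (hc : HasDerivAt c k' 0) :
    (pairing k'.2.2.1 k.2.1 + pairing k.2.2.1 k'.2.1 -
        pairing (conjL k.2.2.1) k'.2.2.1).re = 0 := by
  subst h0
  exact ((hk.2 c hl rfl hc.differentiableAt).unique (Quad.hasDerivAt_act hc)).symm

/-- Variations of the covector over a fixed base loop: the velocity of a critical point is
determined by its momentum. -/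
lemma Quad.IsCrit.conj_mul_add_mul_eq_zero {k : Quad} (hk : k.IsCrit) :
    ∀ᵐ t, conj (k.1 t) * k.2.1 t + k.1 t * k.2.2.1 t = 0 := by
  obtain ⟨x, g, y, h⟩ := k
  obtain ⟨hxg, hyh, hx, hxy⟩ := hk.1
  dsimp only at hxg hyh hx hxy ⊢
  obtain ⟨P, hP⟩ := exists_mul (norm_conjL_eq_one hx) g
  obtain ⟨V, hV⟩ := exists_mul hx y
  have hre := hxg.re_conj_mul_eq_zero hx
  -- `P + V = conj x · x' + x y` is imaginary because both summands are; it is tested against `φ`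
  -- by the variation `y + s i φ conj x`, which moves the covector within the fibre.
  have hD : I • (P + V) = 0 := by
    refine eq_zero_of_integral_smooth ?_ fun φ ψ hφ => ?_
    · filter_upwards [Lp.coeFn_smul I (P + V), Lp.coeFn_add P V, hP, hV, coeFn_conjL x, hre, hxy]
        with t h1 h2 h3 h4 h5 h6 h7
      rw [h1, Pi.smul_apply, h2, Pi.add_apply, h3, h4, h5, smul_eq_mul, I_mul_im, add_re, h6, h7,
        add_zero]
    · have hc1 := hφ.continuous_left
      have hc2 := hφ.continuous_right
      let θ : C(UnitAddCircle, ℂ) := ⟨fun t => I * φ t, by fun_prop⟩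
      let η : C(UnitAddCircle, ℂ) := ⟨fun t => I * ψ t, by fun_prop⟩
      have hs : IsSmoothPair θ η :=
        (hφ.clm ofRealCLM).clm ((ContinuousLinearMap.mul ℝ ℂ) I)
      let b := mulL θ (conjL x)
      let b' := mulL θ (conjL g) + mulL η (conjL x)
      have hb : WeakDeriv b b' := hxg.conj.leibniz hs
      let c : ℝ → Quad := fun s => (x, g, y, h) + s • ((0, 0, b, b') : Quad)
      have hc : HasDerivAt c (0, 0, b, b') 0 := by
        simpa [c] using
          ((hasDerivAt_id (0 : ℝ)).smul_const ((0, 0, b, b') : Quad)).const_add (x, g, y, h)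
      have hc0 : c 0 = (x, g, y, h) := by simp [c]
      have hcs (s : ℝ) : c s = (x, g, y + s • b, h + s • b') := by simp [c]
      have hl (s : ℝ) : (c s).IsLoop := by
        rw [hcs]
        refine ⟨hxg, hyh.add (hb.const_smul (s : ℂ)), hx, ?_⟩
        filter_upwards [Lp.coeFn_add y (s • b), Lp.coeFn_smul s b, hxy, hx, coeFn_conjL x,
          coeFn_mulL θ (conjL x)] with t h1 h2 h3 h4 h5 h6
        rw [h1, Pi.add_apply, h2, Pi.smul_apply, mul_add, add_re, h3, h6, h5]
        have : x t * (s • (θ t * conj (x t))) = (s : ℂ) * (I * φ t) * (x t * conj (x t)) := by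
          change _ * (s • (I * φ t * _)) = _
          rw [real_smul]; ring
        rw [this, mul_conj, normSq_eq_norm_sq, h4]
        simp
      have key := hk.differential_eq_zero hl hc0 hc
      dsimp only at key
      rw [map_zero, add_zero, pairing_apply, pairing_apply, ← integral_sub (integrable_mul_L2 _ _)
        (integrable_mul_L2 _ _)] at key
      rw [← key]
      congr 1
      refine integral_congr_ae ?_
      filter_upwards [Lp.coeFn_smul I (P + V), Lp.coeFn_add P V, hP, hV, coeFn_conjL x,
        coeFn_conjL y, hxy, coeFn_mulL θ (conjL x)] with t h1 h2 h3 h4 h5 h6 h7 h8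
      have h9 : conj (x t) * conj (y t) = -(x t * y t) := by
        rw [← map_mul]
        refine Complex.ext ?_ ?_
        · rw [conj_re, neg_re, h7, neg_zero]
        · rw [conj_im, neg_im]
      rw [h1, Pi.smul_apply, h2, Pi.add_apply, h3, h4, h5, h6, smul_eq_mul]
      change _ = (mulL θ (conjL x)) t * g t - _ * (mulL θ (conjL x)) t
      rw [h8, h5]
      change _ = I * φ t * _ * _ - _ * (I * φ t * _)
      linear_combination (I * φ t) * h9
  have hD' : P + V = 0 := by
    rcases smul_eq_zero.1 hD with h | h
    · exact absurd h I_ne_zero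
    · exact h
  filter_upwards [Lp.coeFn_add P V, hP, hV, coeFn_conjL x,
    Lp.coeFn_zero ℂ 2 (volume : Measure UnitAddCircle)] with t h1 h2 h3 h4 h5
  rw [hD', h5, Pi.add_apply, h2, h3, h4] at h1
  exact h1.symm

/-- The one-parameter family `e^{sτ}` of smooth functions. -/
noncomputable def expFamily (τ : C(UnitAddCircle, ℂ)) (s : ℝ) : C(UnitAddCircle, ℂ) :=
  NormedSpace.exp (s • τ)

lemma expFamily_apply (τ : C(UnitAddCircle, ℂ)) (s : ℝ) (t : UnitAddCircle) :
    expFamily τ s t = Complex.exp (s * τ t) := by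
  have := NormedSpace.map_exp (ContinuousMap.evalAlgHom ℝ ℂ t) (continuous_eval_const t) (s • τ)
  rw [Complex.exp_eq_exp_ℂ, ← real_smul]
  exact this

lemma expFamily_zero (τ : C(UnitAddCircle, ℂ)) : expFamily τ 0 = 1 := by
  rw [expFamily, zero_smul ℝ τ, NormedSpace.exp_zero]

lemma hasDerivAt_expFamily (τ : C(UnitAddCircle, ℂ)) : HasDerivAt (expFamily τ) τ 0 := by
  have := hasDerivAt_exp_smul_const (𝕂 := ℝ) τ (0 : ℝ)
  rw [zero_smul ℝ τ, NormedSpace.exp_zero, one_mul] at this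
  exact this

lemma isSmoothPair_expFamily {τ σ : C(UnitAddCircle, ℂ)} (h : IsSmoothPair τ σ) (s : ℝ) :
    IsSmoothPair (expFamily τ s) (s • (expFamily τ s * σ)) := by
  have he : (fun t : ℝ => expFamily τ s (t : UnitAddCircle)) =
      fun t : ℝ => Complex.exp (s * τ (t : UnitAddCircle)) :=
    funext fun t => expFamily_apply τ s t
  constructor
  · rw [he]
    exact Complex.contDiff_exp.comp (contDiff_const.mul h.contDiff)
  · intro t
    rw [he]
    refine ((h.hasDerivAt t).const_mul (s : ℂ)).cexp.congr_deriv ?_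
    change _ = s • (expFamily τ s t * σ t)
    rw [expFamily_apply, real_smul]
    ring

lemma mulL_one (f : L2C) : mulL 1 f = f := by
  refine Lp.ext ?_
  filter_upwards [coeFn_mulL 1 f] with t ht
  rw [ht]; simp

/-- Conservation of momentum in weak form. The variation rotates the base point by `e^{sτ}` and the
covector by `e^{-sτ}` with `τ = iφ`; it preserves the energy and the product `x y`, and only the
derivative `τ' = iψ` of the rotation contributes to the variation of the action. -/
lemma Quad.IsCrit.integral_mul_mul_eq_zero {k : Quad} (hk : k.IsCrit) {φ ψ : UnitAddCircle → ℝ}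
    (hφ : IsSmoothPair φ ψ) : (∫ t, (ψ t : ℂ) * (I * (k.1 t * k.2.2.1 t))).re = 0 := by
  obtain ⟨x, g, y, h⟩ := k
  obtain ⟨hxg, hyh, hx, hxy⟩ := hk.1
  dsimp only at hxg hyh hx hxy ⊢
  have hc1 := hφ.continuous_left
  have hc2 := hφ.continuous_right
  let τ : C(UnitAddCircle, ℂ) := ⟨fun t => I * φ t, by fun_prop⟩
  let σ : C(UnitAddCircle, ℂ) := ⟨fun t => I * ψ t, by fun_prop⟩
  have hs : IsSmoothPair τ σ :=
    (hφ.clm ofRealCLM).clm ((ContinuousLinearMap.mul ℝ ℂ) I)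
  have hs' : IsSmoothPair (-τ : C(UnitAddCircle, ℂ)) (-σ : C(UnitAddCircle, ℂ)) :=
    hs.clm (-ContinuousLinearMap.id ℝ ℂ)
  let rot (τ σ : C(UnitAddCircle, ℂ)) (f w : L2C) (s : ℝ) : L2C :=
    mulL (expFamily τ s) w + mulL (s • (expFamily τ s * σ)) f
  let c : ℝ → Quad := fun s => (mulL (expFamily τ s) x, rot τ σ x g s,
    mulL (expFamily (-τ) s) y, rot (-τ) (-σ) y h s)
  have hmul (τ : C(UnitAddCircle, ℂ)) (f : L2C) :
      HasDerivAt (fun s => mulL (expFamily τ s) f) (mulL τ f) 0 :=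
    ((mulL.flip f).restrictScalars ℝ).hasFDerivAt.comp_hasDerivAt (0 : ℝ) (hasDerivAt_expFamily τ)
  have hrot (τ σ : C(UnitAddCircle, ℂ)) (f w : L2C) :
      HasDerivAt (rot τ σ f w) (mulL τ w + mulL σ f) 0 := by
    have h1 : HasDerivAt (fun s : ℝ => s • (expFamily τ s * σ)) σ 0 := by
      refine ((hasDerivAt_id (0 : ℝ)).smul ((hasDerivAt_expFamily τ).mul_const σ)).congr_deriv ?_
      rw [id, zero_smul ℝ (τ * σ), zero_add, one_smul ℝ, expFamily_zero, one_mul]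
    exact (hmul τ w).add
      (((mulL.flip f).restrictScalars ℝ).hasFDerivAt.comp_hasDerivAt (0 : ℝ) h1)
  have hc : HasDerivAt c (mulL τ x, mulL τ g + mulL σ x, mulL (-τ) y,
      mulL (-τ) h + mulL (-σ) y) 0 :=
    (hmul τ x).prodMk ((hrot τ σ x g).prodMk ((hmul (-τ) y).prodMk (hrot (-τ) (-σ) y h)))
  have hc0 : c 0 = (x, g, y, h) := by
    simp [c, rot, expFamily_zero, mulL_one]
  have hl (s : ℝ) : (c s).IsLoop := by
    refine ⟨hxg.leibniz (isSmoothPair_expFamily hs s), hyh.leibniz (isSmoothPair_expFamily hs' s),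
      ?_, ?_⟩
    · filter_upwards [hx, coeFn_mulL (expFamily τ s) x] with t h1 h2
      change ‖mulL (expFamily τ s) x t‖ = 1
      rw [h2, norm_mul, h1, expFamily_apply, Complex.norm_exp]
      simp [τ]
    · filter_upwards [hxy, coeFn_mulL (expFamily τ s) x, coeFn_mulL (expFamily (-τ) s) y]
        with t h1 h2 h3
      change (mulL (expFamily τ s) x t * mulL (expFamily (-τ) s) y t).re = 0
      rw [h2, h3, expFamily_apply, expFamily_apply, ContinuousMap.neg_apply, mul_neg,
        Complex.exp_neg, ← h1]
      congr 1
      have := Complex.exp_ne_zero (s * τ t)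
      field_simp
  have key := hk.differential_eq_zero hl hc0 hc
  dsimp only at key
  rw [sub_re, sub_eq_zero] at key
  have e1 : (pairing (conjL y) (mulL (-τ) y)).re = 0 := by
    rw [pairing_apply, ← reCLM_apply, ← reCLM.integral_comp_comm (integrable_mul_L2 _ _)]
    refine integral_eq_zero_of_ae ?_
    filter_upwards [coeFn_conjL y, coeFn_mulL (-τ) y] with t h1 h2
    rw [h1, h2]
    change (conj (y t) * (-(I * φ t) * y t)).re = 0
    have : conj (y t) * (-(I * φ t) * y t) = -(I * φ t) * (y t * conj (y t)) := by ring
    rw [this, mul_conj]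
    simp
  have e2 : pairing (mulL (-τ) y) g + pairing y (mulL τ g + mulL σ x) =
      ∫ t, (ψ t : ℂ) * (I * (x t * y t)) := by
    rw [pairing_apply, pairing_apply, ← integral_add (integrable_mul_L2 _ _)
      (integrable_mul_L2 _ _)]
    refine integral_congr_ae ?_
    filter_upwards [coeFn_mulL (-τ) y, coeFn_mulL τ g, coeFn_mulL σ x,
      Lp.coeFn_add (mulL τ g) (mulL σ x)] with t h1 h2 h3 h4
    rw [h1, h4, Pi.add_apply, h2, h3]
    change -(I * φ t) * _ * _ + _ * (I * φ t * _ + I * ψ t * _) = _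
    ring
  rw [← e2, key, e1]

/-- Along a critical point the momentum `x y` is constant: its weak derivative vanishes, hence so do
its Fourier coefficients of nonzero index. -/
lemma Quad.IsCrit.exists_mul_eq_const {k : Quad} (hk : k.IsCrit) :
    ∃ κ : ℂ, ∀ᵐ t, k.1 t * k.2.2.1 t = κ := by
  obtain ⟨V, hV⟩ := exists_mul hk.1.norm_eq_one k.2.2.1
  have hIV : ∀ᵐ t, (I • V : L2C) t = I * (k.1 t * k.2.2.1 t) := by
    filter_upwards [hV, Lp.coeFn_smul I V] with t h1 h2
    rw [h2, Pi.smul_apply, h1, smul_eq_mul]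
  have hw : WeakDeriv (I • V) 0 := by
    intro φ ψ h1 h2
    have hφ := IsSmoothPair.mk h1 h2
    have hc := hφ.continuous_right
    have e1 : ∫ t, ψ t • (I • V : L2C) t = ∫ t, (ψ t : ℂ) * (I * (k.1 t * k.2.2.1 t)) := by
      refine integral_congr_ae ?_
      filter_upwards [hIV] with t h1
      rw [h1, real_smul]
    have e2 : ∫ t, φ t • (0 : L2C) t = 0 := by
      refine integral_eq_zero_of_ae ?_
      filter_upwards [Lp.coeFn_zero ℂ 2 (volume : Measure UnitAddCircle)] with t h1
      rw [h1]; simp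
    rw [e2, neg_zero, e1]
    refine Complex.ext (hk.integral_mul_mul_eq_zero hφ) ?_
    have hi : Integrable fun t => (ψ t : ℂ) * (I * (k.1 t * k.2.2.1 t)) := by
      refine (integrable_mul (φ := fun t => (ψ t : ℂ)) (by fun_prop)
        (integrable_L2 (I • V))).congr ?_
      filter_upwards [hIV] with t h1
      rw [h1]
    rw [zero_im, ← imCLM_apply, ← imCLM.integral_comp_comm hi]
    refine integral_eq_zero_of_ae ?_
    filter_upwards [hk.1.re_mul_eq_zero] with t ht
    rw [imCLM_apply, im_ofReal_mul, I_mul_im, ht, mul_zero]; rfl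
  have h0 := hasSum_e (I • V)
  have h1 (m : ℤ) (hm : m ≠ 0) : inner ℂ (e m) (I • V) = 0 := by
    have := hw.inner_e_eq m
    rw [inner_zero_right, eq_comm, mul_eq_zero] at this
    refine this.resolve_left ?_
    simp [Real.pi_ne_zero, I_ne_zero, hm]
  have h2 : I • V = inner ℂ (e 0) (I • V) • e 0 :=
    h0.unique (hasSum_single 0 fun m hm => by rw [h1 m hm, zero_smul])
  refine ⟨-I * inner ℂ (e 0) (I • V), ?_⟩
  filter_upwards [hIV, coeFn_e 0, Lp.coeFn_smul (inner ℂ (e 0) (I • V)) (e 0)] with t h3 h4 h5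
  rw [h2, h5, Pi.smul_apply, h4, fourier_zero, smul_eq_mul, mul_one] at h3
  rw [h3, neg_mul, ← mul_assoc, I_mul_I]
  ring

end CircleL2

/-! ### The critical points of the one-dimensional problem -/

namespace CircleL2

open MeasureTheory Complex
open scoped ContDiff ENNReal ComplexConjugate

/-- The loop `t ↦ (l t + u, (2π)² l)` of `T*S¹`, in the coordinates of `ℂ × ℂ*`, together with
its derivative. -/
noncomputable def critQuad (l : ℤ) (u : UnitAddCircle) : Quad :=
  ((u.toCircle : ℂ) • e l,
   (2 * Real.pi * I * l : ℂ) • (u.toCircle : ℂ) • e l,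
   (-(2 * Real.pi * I * l) : ℂ) • ((-u).toCircle : ℂ) • e (-l),
   (-(2 * Real.pi * I * l) : ℂ) • (-(2 * Real.pi * I * l) : ℂ) • ((-u).toCircle : ℂ) • e (-l))

lemma coe_toCircle_neg (u : UnitAddCircle) :
    ((-u).toCircle : ℂ) = conj (u.toCircle : ℂ) := by
  rw [AddCircle.toCircle_neg, Circle.coe_inv_eq_conj]

lemma coe_toCircle_mul_neg (u : UnitAddCircle) :
    (u.toCircle : ℂ) * ((-u).toCircle : ℂ) = 1 := by
  rw [← Circle.coe_mul, ← AddCircle.toCircle_add, add_neg_cancel, AddCircle.toCircle_zero,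
    Circle.coe_one]

lemma fourier_mul_fourier_neg (l : ℤ) (t : UnitAddCircle) : fourier l t * fourier (-l) t = 1 := by
  rw [← fourier_add, add_neg_cancel, fourier_zero]

lemma norm_fourier_apply (l : ℤ) (t : UnitAddCircle) : ‖fourier l t‖ = 1 := by
  rw [fourier_apply, Circle.norm_coe]

lemma coeFn_smul_e (a : ℂ) (l : ℤ) : (a • e l : L2C) =ᵐ[volume] fun t => a * fourier l t := by
  filter_upwards [Lp.coeFn_smul a (e l), coeFn_e l] with t h1 h2
  rw [h1, Pi.smul_apply, h2, smul_eq_mul]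

lemma weakDeriv_smul_e (a : ℂ) (l : ℤ) :
    WeakDeriv (a • e l) ((2 * Real.pi * I * l : ℂ) • a • e l) := by
  rw [smul_comm]
  exact (weakDeriv_e l).const_smul a

lemma weakDeriv_smul_e_neg (a : ℂ) (l : ℤ) :
    WeakDeriv (a • e (-l)) ((-(2 * Real.pi * I * l) : ℂ) • a • e (-l)) := by
  have := weakDeriv_smul_e a (-l)
  rwa [show (2 * Real.pi * I * (-l : ℤ) : ℂ) = -(2 * Real.pi * I * l) by push_cast; ring] at this

lemma isLoop_critQuad (l : ℤ) (u : UnitAddCircle) : (critQuad l u).IsLoop := by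
  refine ⟨weakDeriv_smul_e _ l, (weakDeriv_smul_e_neg _ l).const_smul _, ?_, ?_⟩
  · filter_upwards [coeFn_smul_e (u.toCircle : ℂ) l] with t h1
    change ‖((u.toCircle : ℂ) • e l : L2C) t‖ = 1
    rw [h1, norm_mul, Circle.norm_coe, norm_fourier_apply, one_mul]
  · filter_upwards [coeFn_smul_e (u.toCircle : ℂ) l,
      coeFn_smul_e ((-(2 * Real.pi * I * l) : ℂ) * ((-u).toCircle : ℂ)) (-l)] with t h1 h2
    rw [← smul_smul] at h2
    change (((u.toCircle : ℂ) • e l : L2C) t *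
      ((-(2 * Real.pi * I * l) : ℂ) • ((-u).toCircle : ℂ) • e (-l) : L2C) t).re = 0
    rw [h1, h2]
    have : (u.toCircle : ℂ) * fourier l t *
        (-(2 * Real.pi * I * l) * ((-u).toCircle : ℂ) * fourier (-l) t) =
        -(2 * Real.pi * I * l) * ((u.toCircle : ℂ) * ((-u).toCircle : ℂ)) *
          (fourier l t * fourier (-l) t) := by ring
    rw [this, coe_toCircle_mul_neg, fourier_mul_fourier_neg]
    simp

/-- The critical points of the action of `T*S¹` are the loops of constant velocity. Since the
momentum is constant, `x' = λ x` for a constant `λ`, so that the Fourier series of `x` has a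
single term. -/
lemma Quad.IsCrit.exists_eq_critQuad {k : Quad} (hk : k.IsCrit) : ∃ l u, k = critQuad l u := by
  obtain ⟨κ, hκ⟩ := hk.exists_mul_eq_const
  have hm := hk.conj_mul_add_mul_eq_zero
  obtain ⟨x, g, y, h⟩ := k
  obtain ⟨hxg, hyh, hx, hxy⟩ := hk.1
  dsimp only at hxg hyh hx hxy hκ hm
  have hg : g = (-κ) • x := by
    refine Lp.ext ?_
    filter_upwards [hκ, hm, hx, Lp.coeFn_smul (-κ) x] with t h1 h2 h3 h4
    rw [h4, Pi.smul_apply, smul_eq_mul]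
    have h5 : x t * conj (x t) = 1 := by rw [mul_conj, normSq_eq_norm_sq, h3]; simp
    linear_combination (-g t) * h5 + x t * h2 - x t * h1
  have hne : x ≠ 0 := by
    rintro rfl
    obtain ⟨t, h1, h2⟩ := (hx.and (Lp.coeFn_zero ℂ 2 (volume : Measure UnitAddCircle))).exists
    rw [h2] at h1
    simp at h1
  obtain ⟨l, hl⟩ : ∃ l, inner ℂ (e l) x ≠ 0 := by
    by_contra! hcon
    exact hne (eq_zero_of_inner_e hcon)
  have hcoef (m : ℤ) (hm : inner ℂ (e m) x ≠ 0) : -κ = 2 * Real.pi * I * m := by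
    have := hxg.inner_e_eq m
    rw [hg, inner_smul_right] at this
    exact mul_right_cancel₀ hm this
  have hκl := hcoef l hl
  have hxe : x = inner ℂ (e l) x • e l := by
    refine (hasSum_e x).unique (hasSum_single l fun m hml => ?_)
    by_contra hne
    have h1 := hcoef m (fun h => hne (by rw [h, zero_smul]))
    rw [hκl] at h1
    have h2 := mul_left_cancel₀ (by simp [Real.pi_ne_zero, I_ne_zero]) h1
    exact hml (by exact_mod_cast h2.symm)
  set a : ℂ := inner ℂ (e l) x with ha
  have hna : ‖a‖ = 1 := by
    obtain ⟨t, h1, h2⟩ := (hx.and (coeFn_smul_e a l)).exists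
    rw [hxe, h2, norm_mul, norm_fourier_apply, mul_one] at h1
    exact h1
  obtain ⟨u, hu⟩ : ∃ u : UnitAddCircle, (u.toCircle : ℂ) = a := by
    obtain ⟨u, hu⟩ := (AddCircle.homeomorphCircle one_ne_zero).surjective
      ⟨a, mem_sphere_zero_iff_norm.2 hna⟩
    exact ⟨u, by rw [← AddCircle.homeomorphCircle_apply one_ne_zero, hu]⟩
  have hy : y = (-(2 * Real.pi * I * l) : ℂ) • ((-u).toCircle : ℂ) • e (-l) := by
    rw [smul_smul]
    refine Lp.ext ?_
    filter_upwards [hκ, coeFn_smul_e a l,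
      coeFn_smul_e ((-(2 * Real.pi * I * l) : ℂ) * ((-u).toCircle : ℂ)) (-l)] with t h1 h2 h3
    rw [h3]
    rw [hxe, h2, ← hu] at h1
    have h4 := coe_toCircle_mul_neg u
    have h5 := fourier_mul_fourier_neg l t
    rw [← hκl, neg_neg]
    linear_combination ((-u).toCircle : ℂ) * fourier (-l) t * h1 - y t * h4 -
      (u.toCircle : ℂ) * ((-u).toCircle : ℂ) * y t * h5
  have hx' : x = (u.toCircle : ℂ) • e l := by rw [hu]; exact hxe
  refine ⟨l, u, ?_⟩
  have hh : h = (-(2 * Real.pi * I * l) : ℂ) • y := by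
    refine hyh.unique ?_
    rw [hy]
    exact (weakDeriv_smul_e_neg _ l).const_smul _
  rw [critQuad, ← hy, ← hx', ← hκl, ← hg, hκl, ← hh]

lemma conjL_e (l : ℤ) : conjL (e l) = e (-l) := by
  refine Lp.ext ?_
  filter_upwards [coeFn_conjL (e l), coeFn_e l, coeFn_e (-l)] with t h1 h2 h3
  rw [h1, h2, h3, fourier_neg]

lemma conjL_smul (a : ℂ) (f : L2C) : conjL (a • f) = conj a • conjL f := by
  refine Lp.ext ?_
  filter_upwards [coeFn_conjL (a • f), coeFn_conjL f, Lp.coeFn_smul a f,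
    Lp.coeFn_smul (conj a) (conjL f)] with t h1 h2 h3 h4
  rw [h1, h3, h4, Pi.smul_apply, Pi.smul_apply, h2, smul_eq_mul, smul_eq_mul, map_mul]

lemma pairing_comm (f g : L2C) : pairing f g = pairing g f := by
  simp only [pairing_apply, mul_comm]

lemma norm_sq_eq_one {x : L2C} (hx : ∀ᵐ t, ‖x t‖ = 1) : ‖x‖ ^ 2 = 1 := by
  have h : pairing (conjL x) x = 1 := by
    rw [pairing_apply]
    have : ∫ _ : UnitAddCircle, (1 : ℂ) = 1 := by simp [Measure.real]
    rw [← this]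
    refine integral_congr_ae ?_
    filter_upwards [hx, coeFn_conjL x] with t h1 h2
    rw [h2, mul_comm, mul_conj, normSq_eq_norm_sq, h1]; simp
  rw [norm_sq_eq_pairing, h, one_re]

lemma norm_e (l : ℤ) : ‖e l‖ = 1 := orthonormal_e.1 l

lemma act_critQuad (l : ℤ) (u : UnitAddCircle) :
    (critQuad l u).act = 2 * Real.pi ^ 2 * (l : ℝ) ^ 2 := by
  have h1 : pairing (e (-l)) (e l) = 1 := by
    rw [← conjL_e, ← inner_eq_pairing, inner_self_eq_norm_sq_to_K, norm_e]
    simp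
  simp only [Quad.act, critQuad, map_smul, FunLike.coe_smul, Pi.smul_apply, smul_eq_mul, h1,
    norm_smul, norm_e, Circle.norm_coe, norm_neg, norm_mul]
  have h2 := coe_toCircle_mul_neg u
  have h3 : (2 * Real.pi * I * l : ℂ) * ((u.toCircle : ℂ) *
      (-(2 * Real.pi * I * l) * (((-u).toCircle : ℂ) * 1))) =
      ((4 * Real.pi ^ 2 * l ^ 2 : ℝ) : ℂ) := by
    push_cast
    linear_combination (-(2 * Real.pi * I * l) ^ 2) * h2 - 4 * Real.pi ^ 2 * l ^ 2 * I_sq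
  rw [h3, ofReal_re]
  simp only [RCLike.norm_ofNat, norm_real, Real.norm_eq_abs, norm_I, norm_intCast, mul_one,
    mul_pow, sq_abs]
  ring

lemma WeakDeriv.sub {f w f' w' : L2C} (h : WeakDeriv f w) (h' : WeakDeriv f' w') :
    WeakDeriv (f - f') (w - w') := by
  have := h.add (h'.const_smul (-1))
  simpa [sub_eq_add_neg] using this

/-- Integration by parts. -/
lemma WeakDeriv.pairing_eq {f w a b : L2C} (h : WeakDeriv f w) (h' : WeakDeriv a b) :
    pairing w a = -pairing f b := by
  have hs : IsSmoothPair (1 : C(UnitAddCircle, ℂ)) (0 : C(UnitAddCircle, ℂ)) :=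
    ⟨contDiff_const, fun t => hasDerivAt_const t (1 : ℂ)⟩
  have := h.pairing_mulL h' hs
  rw [mulL_one, mulL_one, map_zero] at this
  simp only [zero_apply, map_zero] at this
  linear_combination this

lemma norm_sub_sq_eq {x x' : L2C} (hx : ‖x‖ ^ 2 = 1) (hx' : ‖x'‖ ^ 2 = 1) :
    (pairing (conjL x) (x' - x)).re = -‖x' - x‖ ^ 2 / 2 := by
  rw [norm_sq_eq_pairing] at *
  simp only [map_sub, FunLike.coe_sub, Pi.sub_apply, sub_re, hx, hx',
    re_pairing_conjL_comm x' x]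
  ring

/-- Near a loop of constant velocity the action of loops in `T*S¹` varies quadratically: the linear
part of the difference is `4π²l² Re ⟪x, x' - x⟫ = -2π²l² ‖x' - x‖²`, because `x` and `x'` lie on
the unit sphere of `L²`. -/
lemma exists_abs_act_sub_le (l : ℤ) (u : UnitAddCircle) : ∃ C : ℝ, ∀ k : Quad, k.IsLoop →
    |k.act - (critQuad l u).act| ≤ C * ‖k - critQuad l u‖ ^ 2 := by
  refine ⟨2 * Real.pi ^ 2 * l ^ 2 + ‖pairing‖ + 1 / 2, ?_⟩
  have h0 := isLoop_critQuad l u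
  -- Hamilton's equations: the derivatives of `x` and `y` are `conj y` and `-4π²l² conj x`.
  have hgy : conjL (critQuad l u).2.2.1 = (critQuad l u).2.1 := by
    simp only [critQuad, conjL_smul, conjL_e, neg_neg, coe_toCircle_neg, conj_conj]
    congr 1
    simp only [map_neg, map_mul, conj_ofReal, conj_I, map_ofNat, map_intCast]
    ring
  have hhx : (critQuad l u).2.2.2 =
      (-(4 * Real.pi ^ 2 * l ^ 2 : ℝ) : ℂ) • conjL (critQuad l u).1 := by
    simp only [critQuad, conjL_smul, conjL_e, coe_toCircle_neg, smul_smul]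
    congr 1
    push_cast
    linear_combination (4 * Real.pi ^ 2 * l ^ 2 * conj (u.toCircle : ℂ)) * I_sq
  generalize critQuad l u = k₀ at h0 hgy hhx ⊢
  intro k hk
  obtain ⟨x, g, y, h⟩ := k₀
  obtain ⟨x', g', y', h'⟩ := k
  have hx1 := norm_sq_eq_one h0.norm_eq_one
  have hx2 := norm_sq_eq_one hk.norm_eq_one
  have hp := (hk.weakDeriv_fst.sub h0.weakDeriv_fst).pairing_eq h0.weakDeriv_snd
  dsimp only at hgy hhx hx1 hx2 hp
  have hlin := norm_sub_sq_eq hx1 hx2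
  have e1 : pairing y (g' - g) = ((4 * Real.pi ^ 2 * l ^ 2 : ℝ) : ℂ) *
      pairing (conjL x) (x' - x) := by
    rw [pairing_comm, hp, hhx, map_smul, pairing_comm, smul_eq_mul]
    ring
  have e2 : ‖y'‖ ^ 2 = ‖y‖ ^ 2 + 2 * (pairing g (y' - y)).re + ‖y' - y‖ ^ 2 := by
    rw [norm_sq_eq_pairing y', norm_sq_eq_pairing y, norm_sq_eq_pairing (y' - y), ← hgy]
    simp only [map_sub, FunLike.coe_sub, Pi.sub_apply, sub_re, re_pairing_conjL_comm y' y]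
    ring
  have e3 : pairing y' g' = pairing y g + pairing g (y' - y) + pairing y (g' - g) +
      pairing (y' - y) (g' - g) := by
    rw [pairing_comm g]
    simp only [map_sub, FunLike.coe_sub, Pi.sub_apply]
    ring
  have e4 : Quad.act (x', g', y', h') - Quad.act (x, g, y, h) =
      -(2 * Real.pi ^ 2 * l ^ 2) * ‖x' - x‖ ^ 2 + (pairing (y' - y) (g' - g)).re -
        ‖y' - y‖ ^ 2 / 2 := by
    simp only [Quad.act]
    rw [e3, e2, e1, add_re, add_re, add_re, re_ofReal_mul, hlin]
    ring
  set δ : Quad := (x', g', y', h') - (x, g, y, h) with hδ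
  have n1 : ‖x' - x‖ ≤ ‖δ‖ := norm_fst_le δ
  have n2 : ‖g' - g‖ ≤ ‖δ‖ := (norm_fst_le δ.2).trans (norm_snd_le δ)
  have n3 : ‖y' - y‖ ≤ ‖δ‖ := (norm_fst_le δ.2.2).trans ((norm_snd_le δ.2).trans (norm_snd_le δ))
  have n4 : |(pairing (y' - y) (g' - g)).re| ≤ ‖pairing‖ * ‖δ‖ ^ 2 := by
    refine (abs_re_le_norm _).trans ((pairing.le_opNorm₂ _ _).trans ?_)
    rw [mul_assoc, sq]
    gcongr
  have n5 : ‖x' - x‖ ^ 2 ≤ ‖δ‖ ^ 2 := by gcongr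
  have n6 : ‖y' - y‖ ^ 2 ≤ ‖δ‖ ^ 2 := by gcongr
  have n7 : (2 * Real.pi ^ 2 * l ^ 2) * ‖x' - x‖ ^ 2 ≤ (2 * Real.pi ^ 2 * l ^ 2) * ‖δ‖ ^ 2 := by
    gcongr
  have n8 : 0 ≤ (2 * Real.pi ^ 2 * l ^ 2) * ‖x' - x‖ ^ 2 := by positivity
  have n9 : 0 ≤ (2 * Real.pi ^ 2 * l ^ 2) * ‖δ‖ ^ 2 := by positivity
  rw [e4]
  obtain ⟨n10, n11⟩ := abs_le.1 n4
  rw [abs_le]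
  constructor <;> nlinarith [sq_nonneg ‖y' - y‖, sq_nonneg ‖δ‖]

/-- Along a differentiable curve of loops, a function which varies quadratically has derivative
zero. -/
lemma isCrit_critQuad (l : ℤ) (u : UnitAddCircle) : (critQuad l u).IsCrit := by
  refine ⟨isLoop_critQuad l u, fun c hl h0 hc => ?_⟩
  obtain ⟨C, hC⟩ := exists_abs_act_sub_le l u
  rw [hasDerivAt_iff_isLittleO]
  have h1 : (fun s => (c s).act - (c 0).act - (s - 0) • (0 : ℝ)) =O[nhds 0]
      fun s => ‖c s - c 0‖ ^ 2 := by
    refine Asymptotics.IsBigO.of_bound C (Filter.Eventually.of_forall fun s => ?_)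
    rw [smul_zero, sub_zero, Real.norm_eq_abs, h0, Real.norm_of_nonneg (by positivity)]
    exact hC _ (hl s)
  have h2 : (fun s => c s - c 0) =O[nhds 0] fun s : ℝ => s - 0 := hc.isBigO_sub
  refine (h1.trans (h2.norm_left.pow 2)).trans_isLittleO ?_
  simp only [sub_zero]
  exact Asymptotics.isLittleO_pow_id one_lt_two

lemma isCrit_iff {k : Quad} : k.IsCrit ↔ ∃ l u, critQuad l u = k :=
  ⟨fun h => by obtain ⟨l, u, h⟩ := h.exists_eq_critQuad; exact ⟨l, u, h.symm⟩,
    by rintro ⟨l, u, rfl⟩; exact isCrit_critQuad l u⟩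

lemma continuous_coe_toCircle : Continuous fun u : UnitAddCircle => (u.toCircle : ℂ) :=
  continuous_subtype_val.comp AddCircle.continuous_toCircle

lemma isInducing_circle_coe : Topology.IsInducing fun z : Circle => (z : ℂ) := ⟨rfl⟩

lemma continuous_critQuad (l : ℤ) : Continuous (critQuad l) := by
  have h1 := continuous_coe_toCircle
  have h2 : Continuous fun u : UnitAddCircle => ((-u).toCircle : ℂ) := h1.comp continuous_neg
  unfold critQuad
  fun_prop

lemma inner_e_critQuad (m l : ℤ) (u : UnitAddCircle) :
    inner ℂ (e m) (critQuad l u).1 = if m = l then (u.toCircle : ℂ) else 0 := by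
  rw [critQuad, inner_smul_right, orthonormal_iff_ite.1 orthonormal_e]
  split_ifs <;> simp

lemma inner_e_critQuad_ne_zero {m l : ℤ} {u : UnitAddCircle} :
    inner ℂ (e m) (critQuad l u).1 ≠ 0 ↔ m = l := by
  rw [inner_e_critQuad]
  simp

lemma critQuad_injective : Function.Injective fun p : ℤ × UnitAddCircle => critQuad p.1 p.2 := by
  rintro ⟨l, u⟩ ⟨l', u'⟩ h
  dsimp only at h
  have h1 : l = l' := by
    rw [← inner_e_critQuad_ne_zero (u := u'), ← h, inner_e_critQuad_ne_zero]
  subst h1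
  have h2 := inner_e_critQuad l l u
  rw [h, inner_e_critQuad, if_pos rfl, if_pos rfl] at h2
  rw [AddCircle.injective_toCircle one_ne_zero (Circle.coe_injective h2)]

/-- The parametrization of the critical points of the action of `T*S¹`. -/
noncomputable def critQuadEquiv : ℤ × UnitAddCircle ≃ {k : Quad // k.IsCrit} :=
  Equiv.ofBijective (fun p => ⟨critQuad p.1 p.2, isCrit_critQuad p.1 p.2⟩)
    ⟨fun p q h => critQuad_injective (congrArg Subtype.val h), fun ⟨k, hk⟩ => by
      obtain ⟨l, u, h⟩ := isCrit_iff.1 hk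
      exact ⟨(l, u), Subtype.ext h⟩⟩

/-- The critical points of the action of `T*S¹` form the disjoint union of the circles of loops with
winding number `l`. The winding number and the initial point depend continuously on the loop,
since they can be read off the Fourier coefficients of `x`. -/
noncomputable def critQuadHomeomorph : ℤ × UnitAddCircle ≃ₜ {k : Quad // k.IsCrit} where
  toEquiv := critQuadEquiv
  continuous_toFun := by
    refine Continuous.subtype_mk (f := fun p : ℤ × UnitAddCircle => critQuad p.1 p.2) ?_ _
    exact continuous_prod_of_discrete_left.2 fun l => continuous_critQuad l
  continuous_invFun := by
    have hinv (k : {k : Quad // k.IsCrit}) :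
        critQuad (critQuadEquiv.symm k).1 (critQuadEquiv.symm k).2 = k.1 :=
      congrArg Subtype.val (critQuadEquiv.apply_symm_apply k)
    have hcoef (m : ℤ) : Continuous fun k : {k : Quad // k.IsCrit} => inner ℂ (e m) k.1.1 := by
      fun_prop
    have hiff (m : ℤ) (k : {k : Quad // k.IsCrit}) :
        inner ℂ (e m) k.1.1 ≠ 0 ↔ m = (critQuadEquiv.symm k).1 := by
      rw [← hinv k, inner_e_critQuad_ne_zero]
    have hloc (k₀ : {k : Quad // k.IsCrit}) :
        ∀ᶠ k in nhds k₀, (critQuadEquiv.symm k).1 = (critQuadEquiv.symm k₀).1 := by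
      filter_upwards [(hcoef _).continuousAt.eventually_ne ((hiff _ k₀).2 rfl)] with k hk
      exact ((hiff _ k).1 hk).symm
    rw [continuous_iff_continuousAt]
    intro k₀
    change ContinuousAt critQuadEquiv.symm k₀
    have h1 : ContinuousAt (fun k => (critQuadEquiv.symm k).1) k₀ :=
      continuousAt_const.congr ((hloc k₀).mono fun k hk => hk.symm)
    have h2 : ContinuousAt (fun k => (critQuadEquiv.symm k).2) k₀ := by
      rw [(AddCircle.homeomorphCircle (T := (1 : ℝ)) one_ne_zero).isInducing.continuousAt_iff]
      refine isInducing_circle_coe.continuousAt_iff.2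
        (((hcoef (critQuadEquiv.symm k₀).1).continuousAt (x := k₀)).congr ?_)
      filter_upwards [hloc k₀] with k hk
      rw [← hinv k, ← hk, inner_e_critQuad, if_pos rfl]
      simp [AddCircle.homeomorphCircle_apply]
    exact h1.prodMk h2

end CircleL2

/-! ### Coordinates on the loop space -/

namespace FloerBott

open MeasureTheory CircleL2
open scoped ContDiff ENNReal ComplexConjugate

variable {n : ℕ}

/-- The coordinate `x_j` of `ℂⁿ × (ℂⁿ)*`. -/
noncomputable def projX (j : Fin n) : Ambient n →L[ℝ] ℂ :=
  (PiLp.proj 2 (fun _ : Fin n => ℂ) j).comp (WithLp.fstL 2 ℝ (Cn n) (Cn n))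

/-- The coordinate `y_j` of `ℂⁿ × (ℂⁿ)*`. -/
noncomputable def projY (j : Fin n) : Ambient n →L[ℝ] ℂ :=
  (PiLp.proj 2 (fun _ : Fin n => ℂ) j).comp (WithLp.sndL 2 ℝ (Cn n) (Cn n))

/-- The inclusion of the coordinate axis of `x_j`. -/
noncomputable def inclX (j : Fin n) : ℂ →L[ℝ] Ambient n :=
  ((WithLp.prodContinuousLinearEquiv 2 ℝ (Cn n) (Cn n)).symm : Cn n × Cn n →L[ℝ] Ambient n).comp
    ((ContinuousLinearMap.inl ℝ (Cn n) (Cn n)).comp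
      (((PiLp.continuousLinearEquiv 2 ℝ fun _ : Fin n => ℂ).symm : (Fin n → ℂ) →L[ℝ] Cn n).comp
        (ContinuousLinearMap.single ℝ (fun _ : Fin n => ℂ) j)))

/-- The inclusion of the coordinate axis of `y_j`. -/
noncomputable def inclY (j : Fin n) : ℂ →L[ℝ] Ambient n :=
  ((WithLp.prodContinuousLinearEquiv 2 ℝ (Cn n) (Cn n)).symm : Cn n × Cn n →L[ℝ] Ambient n).comp
    ((ContinuousLinearMap.inr ℝ (Cn n) (Cn n)).comp
      (((PiLp.continuousLinearEquiv 2 ℝ fun _ : Fin n => ℂ).symm : (Fin n → ℂ) →L[ℝ] Cn n).comp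
        (ContinuousLinearMap.single ℝ (fun _ : Fin n => ℂ) j)))

lemma projX_inclX (i j : Fin n) (c : ℂ) : projX i (inclX j c) = if i = j then c else 0 := by
  change (Pi.single j c : Fin n → ℂ) i = _
  rw [Pi.single_apply]

lemma projY_inclY (i j : Fin n) (c : ℂ) : projY i (inclY j c) = if i = j then c else 0 := by
  change (Pi.single j c : Fin n → ℂ) i = _
  rw [Pi.single_apply]

lemma ambient_ext {p q : Ambient n} (hx : ∀ j, projX j p = projX j q)
    (hy : ∀ j, projY j p = projY j q) : p = q := by
  refine (WithLp.equiv 2 _).injective (Prod.ext ?_ ?_)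
  · exact PiLp.ext hx
  · exact PiLp.ext hy

/-- `T*Tⁿ` is cut out coordinate by coordinate; the covector component is recovered as
`v_j = -2π Im (x_j y_j)`. -/
lemma mem_cotangentTorus_iff {p : Ambient n} :
    p ∈ cotangentTorus n ↔ ∀ j, ‖projX j p‖ = 1 ∧ (projX j p * projY j p).re = 0 := by
  constructor
  · rintro ⟨u, v, rfl⟩ j
    refine ⟨Circle.norm_coe _, ?_⟩
    change (((u j).toCircle : ℂ) *
      (-(Complex.I / (2 * (Real.pi : ℂ))) * (v j : ℂ) * ((-(u j)).toCircle : ℂ))).re = 0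
    have h := coe_toCircle_mul_neg (u j)
    have : ((u j).toCircle : ℂ) *
        (-(Complex.I / (2 * (Real.pi : ℂ))) * (v j : ℂ) * ((-(u j)).toCircle : ℂ)) =
        ((-(v j / (2 * Real.pi)) : ℝ) : ℂ) * Complex.I := by
      push_cast
      linear_combination (-(Complex.I / (2 * (Real.pi : ℂ))) * (v j : ℂ)) * h
    rw [this, Complex.re_ofReal_mul, Complex.I_re, mul_zero]
  · intro h
    have hu (j : Fin n) : ∃ u : UnitAddCircle, (u.toCircle : ℂ) = projX j p := by
      obtain ⟨u, hu⟩ := (AddCircle.homeomorphCircle one_ne_zero).surjective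
        ⟨projX j p, mem_sphere_zero_iff_norm.2 (h j).1⟩
      exact ⟨u, by rw [← AddCircle.homeomorphCircle_apply one_ne_zero, hu]⟩
    choose u hu using hu
    refine ⟨u, fun j => -(2 * Real.pi) * (projX j p * projY j p).im, ambient_ext hu fun j => ?_⟩
    change -(Complex.I / (2 * (Real.pi : ℂ))) *
      ((-(2 * Real.pi) * (projX j p * projY j p).im : ℝ) : ℂ) * ((-(u j)).toCircle : ℂ) = _
    have h1 := coe_toCircle_mul_neg (u j)
    have h2 : (projX j p * projY j p) = ((projX j p * projY j p).im : ℂ) * Complex.I :=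
      Complex.ext (by rw [Complex.re_ofReal_mul, Complex.I_re, mul_zero, (h j).2])
        (by rw [Complex.im_ofReal_mul, Complex.I_im, mul_one])
    have h3 : (Real.pi : ℂ) ≠ 0 := by exact_mod_cast Real.pi_ne_zero
    rw [hu] at h1
    push_cast
    field_simp
    linear_combination -((-(u j)).toCircle : ℂ) * h2 + projY j p * h1

/-- The four coordinate functions with index `j` of a loop and its derivative. -/
noncomputable def coordL : Pair n →L[ℝ] (Fin n → Quad) :=
  ContinuousLinearMap.pi fun j =>
    (((projX j).compLpL 2 volume).comp (WithLp.fstL 2 ℝ (L2 n) (L2 n))).prod <|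
    (((projX j).compLpL 2 volume).comp (WithLp.sndL 2 ℝ (L2 n) (L2 n))).prod <|
    (((projY j).compLpL 2 volume).comp (WithLp.fstL 2 ℝ (L2 n) (L2 n))).prod <|
    (((projY j).compLpL 2 volume).comp (WithLp.sndL 2 ℝ (L2 n) (L2 n)))

/-- The square-integrable map with given coordinate functions. -/
noncomputable def ofCoord : (Fin n → L2C × L2C) →L[ℝ] L2 n :=
  ∑ j, ((((inclX j).compLpL 2 volume).coprod ((inclY j).compLpL 2 volume)).comp
    (ContinuousLinearMap.proj j))

lemma coordL_apply (z : Pair n) (j : Fin n) : coordL z j =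
    ((projX j).compLp z.fst, (projX j).compLp z.snd, (projY j).compLp z.fst,
      (projY j).compLp z.snd) := rfl

lemma compLp_compLp {E F G : Type*} [NormedAddCommGroup E] [NormedSpace ℝ E]
    [NormedAddCommGroup F] [NormedSpace ℝ F] [NormedAddCommGroup G] [NormedSpace ℝ G]
    (L : F →L[ℝ] G) (M : E →L[ℝ] F) (f : Lp E 2 (volume : Measure UnitAddCircle)) :
    L.compLp (M.compLp f) = (L.comp M).compLp f := by
  refine Lp.ext ?_
  filter_upwards [L.coeFn_compLp (M.compLp f), M.coeFn_compLp f, (L.comp M).coeFn_compLp f]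
    with t h1 h2 h3
  rw [h1, h2, h3]; rfl

lemma zero_compLp_L2 {E F : Type*} [NormedAddCommGroup E] [NormedSpace ℝ E]
    [NormedAddCommGroup F] [NormedSpace ℝ F] (f : Lp E 2 (volume : Measure UnitAddCircle)) :
    (0 : E →L[ℝ] F).compLp f = 0 := by
  refine Lp.ext ?_
  filter_upwards [(0 : E →L[ℝ] F).coeFn_compLp f,
    Lp.coeFn_zero F 2 (volume : Measure UnitAddCircle)] with t h1 h2
  rw [h1, h2]; rfl

lemma id_compLp {E : Type*} [NormedAddCommGroup E] [NormedSpace ℝ E]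
    (f : Lp E 2 (volume : Measure UnitAddCircle)) :
    (ContinuousLinearMap.id ℝ E).compLp f = f := by
  refine Lp.ext ?_
  filter_upwards [(ContinuousLinearMap.id ℝ E).coeFn_compLp f] with t h1
  rw [h1]; rfl

lemma projX_ofCoord (p : Fin n → L2C × L2C) (i : Fin n) :
    (projX i).compLp (ofCoord p) = (p i).1 := by
  change (projX i).compLpL 2 volume (ofCoord p) = _
  rw [ofCoord, sum_apply, map_sum, Finset.sum_eq_single i]
  · change (projX i).compLpL 2 volume ((inclX i).compLp (p i).1 + (inclY i).compLp (p i).2) = _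
    rw [map_add]
    change (projX i).compLp ((inclX i).compLp (p i).1) +
      (projX i).compLp ((inclY i).compLp (p i).2) = _
    have h1 : (projX i).comp (inclX i) = ContinuousLinearMap.id ℝ ℂ := by
      ext1 c; simp [projX_inclX]
    have h2 : (projX i).comp (inclY i) = 0 := rfl
    rw [compLp_compLp, compLp_compLp, h1, h2, id_compLp, zero_compLp_L2, add_zero]
  · intro j _ hj
    change (projX i).compLpL 2 volume ((inclX j).compLp (p j).1 + (inclY j).compLp (p j).2) = _
    rw [map_add]
    change (projX i).compLp ((inclX j).compLp (p j).1) +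
      (projX i).compLp ((inclY j).compLp (p j).2) = _
    have h1 : (projX i).comp (inclX j) = 0 := by
      ext1 c; simp [projX_inclX, hj.symm]
    have h2 : (projX i).comp (inclY j) = 0 := rfl
    rw [compLp_compLp, compLp_compLp, h1, h2, zero_compLp_L2, zero_compLp_L2, add_zero]
  · simp

lemma projY_ofCoord (p : Fin n → L2C × L2C) (i : Fin n) :
    (projY i).compLp (ofCoord p) = (p i).2 := by
  change (projY i).compLpL 2 volume (ofCoord p) = _
  rw [ofCoord, sum_apply, map_sum, Finset.sum_eq_single i]
  · change (projY i).compLpL 2 volume ((inclX i).compLp (p i).1 + (inclY i).compLp (p i).2) = _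
    rw [map_add]
    change (projY i).compLp ((inclX i).compLp (p i).1) +
      (projY i).compLp ((inclY i).compLp (p i).2) = _
    have h1 : (projY i).comp (inclY i) = ContinuousLinearMap.id ℝ ℂ := by
      ext1 c; simp [projY_inclY]
    have h2 : (projY i).comp (inclX i) = 0 := rfl
    rw [compLp_compLp, compLp_compLp, h1, h2, id_compLp, zero_compLp_L2, zero_add]
  · intro j _ hj
    change (projY i).compLpL 2 volume ((inclX j).compLp (p j).1 + (inclY j).compLp (p j).2) = _
    rw [map_add]
    change (projY i).compLp ((inclX j).compLp (p j).1) +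
      (projY i).compLp ((inclY j).compLp (p j).2) = _
    have h1 : (projY i).comp (inclY j) = 0 := by
      ext1 c; simp [projY_inclY, hj.symm]
    have h2 : (projY i).comp (inclX j) = 0 := rfl
    rw [compLp_compLp, compLp_compLp, h1, h2, zero_compLp_L2, zero_compLp_L2, add_zero]
  · simp

lemma L2_ext {f f' : L2 n} (hx : ∀ j, (projX j).compLp f = (projX j).compLp f')
    (hy : ∀ j, (projY j).compLp f = (projY j).compLp f') : f = f' := by
  refine Lp.ext ?_
  have key (L : Fin n → Ambient n →L[ℝ] ℂ) (h : ∀ j, (L j).compLp f = (L j).compLp f') :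
      ∀ᵐ t, ∀ j, L j (f t) = L j (f' t) := by
    refine ae_all_iff.2 fun j => ?_
    filter_upwards [(L j).coeFn_compLp f, (L j).coeFn_compLp f'] with t h1 h2
    rw [← h1, ← h2, h j]
  filter_upwards [key projX hx, key projY hy] with t h1 h2
  exact ambient_ext h1 h2

lemma coordL_injective : Function.Injective (coordL : Pair n → Fin n → Quad) := by
  intro z z' h
  have hj (j : Fin n) := congrFun h j
  simp only [coordL_apply, Prod.mk.injEq] at hj
  refine (WithLp.equiv 2 _).injective (Prod.ext ?_ ?_)
  · exact L2_ext (fun j => (hj j).1) fun j => (hj j).2.2.1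
  · exact L2_ext (fun j => (hj j).2.1) fun j => (hj j).2.2.2

/-- The loop with given coordinate functions. -/
noncomputable def pairOfCoord (K : Fin n → Quad) : Pair n :=
  WithLp.toLp 2 (ofCoord fun j => ((K j).1, (K j).2.2.1), ofCoord fun j => ((K j).2.1, (K j).2.2.2))

lemma coordL_pairOfCoord (K : Fin n → Quad) : coordL (pairOfCoord K) = K := by
  funext j
  rw [coordL_apply]
  exact Prod.ext (projX_ofCoord _ j) (Prod.ext (projX_ofCoord _ j)
    (Prod.ext (projY_ofCoord _ j) (projY_ofCoord _ j)))

lemma continuous_pairOfCoord : Continuous (pairOfCoord : (Fin n → Quad) → Pair n) :=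
  (WithLp.prod_continuous_toLp 2 _ _).comp
    ((ofCoord.continuous.comp (by fun_prop)).prodMk (ofCoord.continuous.comp (by fun_prop)))

/-- Coordinates identify pairs of maps to `ℂⁿ × (ℂⁿ)*` with families of quadruples. -/
noncomputable def coordEquiv (n : ℕ) : Pair n ≃L[ℝ] (Fin n → Quad) where
  __ := (coordL : Pair n →L[ℝ] (Fin n → Quad))
  invFun := pairOfCoord
  left_inv _ := coordL_injective (coordL_pairOfCoord _)
  right_inv := coordL_pairOfCoord
  continuous_toFun := coordL.continuous
  continuous_invFun := continuous_pairOfCoord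

lemma coordEquiv_apply (z : Pair n) (j : Fin n) : (coordEquiv n) z j =
    ((projX j).compLp z.fst, (projX j).compLp z.snd, (projY j).compLp z.fst,
      (projY j).compLp z.snd) := rfl

lemma isWeakDeriv_iff {f w : L2 n} : IsWeakDeriv f w ↔
    ∀ j, WeakDeriv ((projX j).compLp f) ((projX j).compLp w) ∧
      WeakDeriv ((projY j).compLp f) ((projY j).compLp w) := by
  refine ⟨fun h j => ⟨WeakDeriv.clm _ h, WeakDeriv.clm _ h⟩, fun h φ ψ h1 h2 => ?_⟩
  have hφ := IsSmoothPair.mk h1 h2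
  have key (L : Ambient n →L[ℝ] ℂ) (hL : WeakDeriv (L.compLp f) (L.compLp w)) :
      L (∫ t, ψ t • f t) = L (-∫ t, φ t • w t) := by
    rw [map_neg, ← integral_smul_compLp L hφ.continuous_right,
      ← integral_smul_compLp L hφ.continuous_left]
    exact hL φ ψ h1 h2
  exact ambient_ext (fun j => key _ (h j).1) fun j => key _ (h j).2

lemma mem_loopSpace_iff {z : Pair n} : z ∈ loopSpace n ↔ ∀ j, (coordEquiv n z j).IsLoop := by
  have hae : (∀ᵐ t, z.fst t ∈ cotangentTorus n) ↔ ∀ j, (∀ᵐ t, ‖(coordEquiv n z j).1 t‖ = 1) ∧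
      ∀ᵐ t, ((coordEquiv n z j).1 t * (coordEquiv n z j).2.2.1 t).re = 0 := by
    simp only [mem_cotangentTorus_iff, ae_all_iff, ← Filter.eventually_and]
    refine forall_congr' fun j => Filter.eventually_congr ?_
    filter_upwards [(projX j).coeFn_compLp z.fst, (projY j).coeFn_compLp z.fst] with t h1 h2
    rw [coordEquiv_apply, h1, h2]
  change IsWeakDeriv z.fst z.snd ∧ _ ↔ _
  rw [hae, isWeakDeriv_iff]
  exact ⟨fun h j => ⟨(h.1 j).1, (h.1 j).2, (h.2 j).1, (h.2 j).2⟩,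
    fun h => ⟨fun j => ⟨(h j).1, (h j).2⟩, fun j => ⟨(h j).3, (h j).4⟩⟩⟩

/-- The action is the sum of the actions of the coordinates. -/
lemma action_eq_sum (z : Pair n) : action z = ∑ j, (coordEquiv n z j).act := by
  have e1 : ∫ t, liouville (z.fst t) (z.snd t) =
      ∑ j, (pairing (coordEquiv n z j).2.2.1 (coordEquiv n z j).2.1).re := by
    have (j : Fin n) : (pairing (coordEquiv n z j).2.2.1 (coordEquiv n z j).2.1).re =
        ∫ t, ((coordEquiv n z j).2.2.1 t * (coordEquiv n z j).2.1 t).re := by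
      rw [pairing_apply, ← Complex.reCLM_apply,
        ← Complex.reCLM.integral_comp_comm (integrable_mul_L2 _ _)]
      rfl
    have hi (j : Fin n) : Integrable fun t =>
        ((coordEquiv n z j).2.2.1 t * (coordEquiv n z j).2.1 t).re := (integrable_mul_L2 _ _).re
    simp only [this]
    rw [← integral_finsetSum _ fun j _ => hi j]
    refine integral_congr_ae ?_
    have h1 : ∀ᵐ t, ∀ j, (coordEquiv n z j).2.2.1 t = projY j (z.fst t) :=
      ae_all_iff.2 fun j => (projY j).coeFn_compLp z.fst
    have h2 : ∀ᵐ t, ∀ j, (coordEquiv n z j).2.1 t = projX j (z.snd t) :=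
      ae_all_iff.2 fun j => (projX j).coeFn_compLp z.snd
    filter_upwards [h1, h2] with t h1 h2
    simp only [h1, h2, liouville, Complex.re_sum]
    rfl
  have e2 : ∫ t, hamiltonian (z.fst t) = ∑ j, ‖(coordEquiv n z j).2.2.1‖ ^ 2 / 2 := by
    have (j : Fin n) : ‖(coordEquiv n z j).2.2.1‖ ^ 2 / 2 =
        ∫ t, ‖(coordEquiv n z j).2.2.1 t‖ ^ 2 / 2 := by
      rw [integral_div, norm_sq_eq_integral]
    simp only [this]
    rw [← integral_finsetSum _ fun j _ =>
      ((Lp.memLp _).integrable_norm_pow two_ne_zero).div_const 2]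
    refine integral_congr_ae ?_
    have h1 : ∀ᵐ t, ∀ j, (coordEquiv n z j).2.2.1 t = projY j (z.fst t) :=
      ae_all_iff.2 fun j => (projY j).coeFn_compLp z.fst
    filter_upwards [h1] with t h1
    simp only [h1, hamiltonian, EuclideanSpace.norm_sq_eq, Finset.sum_div]
    rfl
  rw [action, e1, e2, ← Finset.sum_sub_distrib]
  rfl

/-- The action is a sum over the coordinates, so a loop is critical exactly when each of its
coordinates is. -/
lemma mem_crit_iff {z : Pair n} : z ∈ crit n ↔ ∀ j, (coordEquiv n z j).IsCrit := by
  constructor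
  · rintro ⟨hz, hcrit⟩ j
    refine ⟨mem_loopSpace_iff.1 hz j, fun c hl h0 hc => ?_⟩
    let C : ℝ → Pair n := fun s => (coordEquiv n).symm (Function.update (coordEquiv n z) j (c s))
    have hC (s : ℝ) : (coordEquiv n) (C s) = Function.update (coordEquiv n z) j (c s) :=
      (coordEquiv n).apply_symm_apply _
    have hCl (s : ℝ) : C s ∈ loopSpace n := by
      refine mem_loopSpace_iff.2 fun i => ?_
      rw [hC]
      rcases eq_or_ne i j with rfl | hij
      · rw [Function.update_self]; exact hl s
      · rw [Function.update_of_ne hij]; exact mem_loopSpace_iff.1 hz i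
    have hC0 : C 0 = z := by
      simp only [C]
      rw [h0, Function.update_eq_self, (coordEquiv n).symm_apply_apply]
    have hCd : DifferentiableAt ℝ C 0 := by
      refine (coordEquiv n).symm.differentiableAt.comp (0 : ℝ) (differentiableAt_pi.2 fun i => ?_)
      rcases eq_or_ne i j with rfl | hij
      · simpa only [Function.update_self] using hc
      · simp only [Function.update_of_ne hij]
        exact differentiableAt_const _
    have hact (s : ℝ) : action (C s) =
        (c s).act + ∑ i ∈ Finset.univ.erase j, (coordEquiv n z i).act := by
      rw [action_eq_sum, ← Finset.add_sum_erase _ _ (Finset.mem_univ j), hC, Function.update_self]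
      congr 1
      refine Finset.sum_congr rfl fun i hi => ?_
      rw [Function.update_of_ne (Finset.ne_of_mem_erase hi)]
    have key := (hcrit C hCl hC0 hCd).sub_const
      (∑ i ∈ Finset.univ.erase j, (coordEquiv n z i).act)
    simpa only [hact, add_sub_cancel_right] using key
  · intro h
    refine ⟨mem_loopSpace_iff.2 fun j => (h j).1, fun c hl h0 hc => ?_⟩
    have hj (j : Fin n) : HasDerivAt (fun s => (coordEquiv n (c s) j).act) 0 0 := by
      refine (h j).2 (fun s => coordEquiv n (c s) j) (fun s => mem_loopSpace_iff.1 (hl s) j)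
        (by rw [h0]) ?_
      exact differentiableAt_pi.1 ((coordEquiv n).differentiableAt.comp (0 : ℝ) hc) j
    have := HasDerivAt.fun_sum fun j (_ : j ∈ Finset.univ) => hj j
    simpa only [action_eq_sum, Finset.sum_const_zero] using this

end FloerBott

/-! ### The critical points and their action -/

namespace FloerBott

open MeasureTheory CircleL2
open scoped ContDiff ENNReal ComplexConjugate

variable {n : ℕ}

/-- The critical points of the action on `ΛT*Tⁿ` are parametrized by the winding vector and the
initial point, one critical point of the action on `ΛT*S¹` in each coordinate. -/
noncomputable def critHomeomorph (n : ℕ) : (Fin n → ℤ) × Torus n ≃ₜ crit n where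
  toFun p := ⟨(coordEquiv n).symm fun j => (critQuadHomeomorph (p.1 j, p.2 j)).1,
    mem_crit_iff.2 fun j => by
      rw [(coordEquiv n).apply_symm_apply]; exact (critQuadHomeomorph (p.1 j, p.2 j)).2⟩
  invFun z := (fun j => (critQuadHomeomorph.symm ⟨(coordEquiv n) z.1 j, mem_crit_iff.1 z.2 j⟩).1,
    fun j => (critQuadHomeomorph.symm ⟨(coordEquiv n) z.1 j, mem_crit_iff.1 z.2 j⟩).2)
  left_inv p := by simp
  right_inv z := by simp
  continuous_toFun := by
    refine Continuous.subtype_mk ((coordEquiv n).symm.continuous.comp (continuous_pi fun j => ?_)) _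
    exact continuous_subtype_val.comp (critQuadHomeomorph.continuous.comp (by fun_prop))
  continuous_invFun := by
    have h (j : Fin n) : Continuous fun z : crit n =>
        critQuadHomeomorph.symm ⟨(coordEquiv n) z.1 j, mem_crit_iff.1 z.2 j⟩ :=
      critQuadHomeomorph.symm.continuous.comp <| Continuous.subtype_mk
        ((continuous_apply j).comp ((coordEquiv n).continuous.comp continuous_subtype_val)) _
    exact (continuous_pi fun j => (h j).fst).prodMk (continuous_pi fun j => (h j).snd)

lemma coordEquiv_critHomeomorph (l : Fin n → ℤ) (u : Torus n) (j : Fin n) :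
    (coordEquiv n) (critHomeomorph n (l, u)).1 j = critQuad (l j) (u j) :=
  congrFun ((coordEquiv n).apply_symm_apply fun j => (critQuadHomeomorph (l j, u j)).1) j

lemma intNorm_sq (l : Fin n → ℤ) : intNorm l ^ 2 = ∑ j, (l j : ℝ) ^ 2 :=
  Real.sq_sqrt (Finset.sum_nonneg fun _ _ => sq_nonneg _)

lemma action_critHomeomorph (l : Fin n → ℤ) (u : Torus n) :
    action (critHomeomorph n (l, u)).1 = 2 * Real.pi ^ 2 * intNorm l ^ 2 := by
  simp only [action_eq_sum, coordEquiv_critHomeomorph, act_critQuad, intNorm_sq, Finset.mul_sum]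

lemma coe_toCircle_zsmul_add (l : ℤ) (t u : UnitAddCircle) :
    ((l • t + u).toCircle : ℂ) = (u.toCircle : ℂ) * fourier l t := by
  rw [fourier_apply, AddCircle.toCircle_add, Circle.coe_mul, mul_comm]

/-- In the coordinate with index `j` both sides are multiples of the character `e^{±2πi l_j t}`. -/
lemma critHomeomorph_ae_eq (l : Fin n → ℤ) (u : Torus n) :
    ∀ᵐ t, (critHomeomorph n (l, u)).1.fst t = critLoop l u t := by
  have hx (j : Fin n) : ∀ᵐ t, projX j ((critHomeomorph n (l, u)).1.fst t) =
      projX j (critLoop l u t) := by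
    have h := congrArg Prod.fst (coordEquiv_critHomeomorph l u j)
    rw [coordEquiv_apply] at h
    filter_upwards [(projX j).coeFn_compLp (critHomeomorph n (l, u)).1.fst,
      coeFn_smul_e ((u j).toCircle : ℂ) (l j)] with t h1 h2
    rw [← h1]
    change ((projX j).compLp (critHomeomorph n (l, u)).1.fst) t =
      ((l j • t + u j).toCircle : ℂ)
    rw [coe_toCircle_zsmul_add, ← h2]
    exact congrArg (fun f : L2C => f t) h
  have hy (j : Fin n) : ∀ᵐ t, projY j ((critHomeomorph n (l, u)).1.fst t) =
      projY j (critLoop l u t) := by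
    have h := congrArg (fun k : Quad => k.2.2.1) (coordEquiv_critHomeomorph l u j)
    rw [coordEquiv_apply] at h
    dsimp only [critQuad] at h
    rw [smul_smul] at h
    filter_upwards [(projY j).coeFn_compLp (critHomeomorph n (l, u)).1.fst,
      coeFn_smul_e (-(2 * Real.pi * Complex.I * l j) * ((-(u j)).toCircle : ℂ)) (-(l j))]
      with t h1 h2
    rw [← h1, h, h2]
    change _ = -(Complex.I / (2 * (Real.pi : ℂ))) * (((2 * Real.pi) ^ 2 * (l j : ℝ) : ℝ) : ℂ) *
      ((-(l j • t + u j)).toCircle : ℂ)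
    rw [neg_add, ← neg_smul, coe_toCircle_zsmul_add]
    have h3 : (Real.pi : ℂ) ≠ 0 := by exact_mod_cast Real.pi_ne_zero
    push_cast
    field_simp
  filter_upwards [ae_all_iff.2 hx, ae_all_iff.2 hy] with t h1 h2
  exact ambient_ext h1 h2

noncomputable def sigmaTorusHomeomorphProd (n : ℕ) :
    (Σ _ : Fin n → ℤ, Torus n) ≃ₜ (Fin n → ℤ) × Torus n where
  toEquiv := Equiv.sigmaEquivProd _ _
  continuous_toFun := continuous_sigma fun l => by
    change Continuous fun u : Torus n => (l, u)
    fun_prop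
  continuous_invFun := continuous_prod_of_discrete_left.2 fun l => by
    change Continuous fun u : Torus n => (⟨l, u⟩ : Σ _ : Fin n → ℤ, Torus n)
    exact continuous_sigmaMk (σ := fun _ : Fin n → ℤ => Torus n)

lemma mem_critBelow_iff (l k : Fin n → ℤ) (u : Torus n) :
    (critHomeomorph n (l, u)).1 ∈ critBelow n (2 * Real.pi ^ 2 * intNorm k ^ 2) ↔
      intNorm l ≤ intNorm k := by
  change _ ∧ _ ↔ _
  rw [and_iff_right (critHomeomorph n (l, u)).2, action_critHomeomorph,
    mul_le_mul_iff_right₀ (by positivity)]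
  exact sq_le_sq₀ (Real.sqrt_nonneg _) (Real.sqrt_nonneg _)

/-- The critical points of action at most `2π²|k|²` form one torus for each `l` with `|l| ≤ |k|`. -/
noncomputable def critBelowHomeomorph (k : Fin n → ℤ) :
    critBelow n (2 * Real.pi ^ 2 * intNorm k ^ 2) ≃ₜ
      Torus n × {l : Fin n → ℤ // intNorm l ≤ intNorm k} where
  toFun z := (((critHomeomorph n).symm ⟨z.1, z.2.1⟩).2,
    ⟨((critHomeomorph n).symm ⟨z.1, z.2.1⟩).1, by
      rw [← mem_critBelow_iff _ _ ((critHomeomorph n).symm ⟨z.1, z.2.1⟩).2, Prod.mk.eta,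
        Homeomorph.apply_symm_apply]
      exact z.2⟩)
  invFun p := ⟨(critHomeomorph n (p.2.1, p.1)).1, (mem_critBelow_iff _ _ _).2 p.2.2⟩
  left_inv z := by simp
  right_inv p := by simp
  continuous_toFun := by
    have h : Continuous fun z : critBelow n (2 * Real.pi ^ 2 * intNorm k ^ 2) =>
        (critHomeomorph n).symm ⟨z.1, z.2.1⟩ :=
      (critHomeomorph n).symm.continuous.comp (Continuous.subtype_mk continuous_subtype_val _)
    exact h.snd.prodMk (h.fst.subtype_mk _)
  continuous_invFun := Continuous.subtype_mk (continuous_subtype_val.comp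
    ((critHomeomorph n).continuous.comp (by fun_prop))) _

end FloerBott

theorem mainTheorem1 (n : ℕ) (hn : 1 ≤ n) :
    (∃ Φ : (Σ _ : Fin n → ℤ, FloerBott.Torus n) ≃ₜ FloerBott.crit n,
      ∀ (l : Fin n → ℤ) (u₀ : FloerBott.Torus n),
        (∀ᵐ t : UnitAddCircle,
          (Φ ⟨l, u₀⟩ : FloerBott.Pair n).fst t = FloerBott.critLoop l u₀ t) ∧
        FloerBott.action (Φ ⟨l, u₀⟩ : FloerBott.Pair n) =
          2 * Real.pi ^ 2 * FloerBott.intNorm l ^ 2) ∧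
    ∀ k : Fin n → ℤ,
      (∀ i : ℕ, i ≤ n → Nonempty
        (FloerBott.floerCohomology n (2 * Real.pi ^ 2 * FloerBott.intNorm k ^ 2) (-(i : ℤ))
          ≃ₗ[ℤ] ⨁ _ : {l : Fin n → ℤ // FloerBott.intNorm l ≤ FloerBott.intNorm k},
            (Fin (n.choose i) → ℤ))) ∧
      (∀ m : ℤ, (m < -(n : ℤ) ∨ 0 < m) → Subsingleton
        (FloerBott.floerCohomology n (2 * Real.pi ^ 2 * FloerBott.intNorm k ^ 2) m)) := by
  refine ⟨⟨(FloerBott.sigmaTorusHomeomorphProd n).trans (FloerBott.critHomeomorph n), fun l u₀ =>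
    ⟨FloerBott.critHomeomorph_ae_eq l u₀, FloerBott.action_critHomeomorph l u₀⟩⟩, fun k => ?_⟩
  exact FloerBott.floerCohomology_of_homeomorph (FloerBott.critBelowHomeomorph k)
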